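/- Let $(M,g)$ be a smooth Riemannian manifold without boundary, of dimension $n$, with Levi-Civita connection $\nabla$. Let $C^\infty(S^r)$ be the space of smooth symmetric covariant tensor fields of rank $r$ on $M$ (real- or complex-valued), with $S^{-1}=0$, and let $\sigma$ denote symmetrization. Define - the inner differentiation $d=\sigma\nabla:C^\infty(S^r)\to C^\infty(S^{r+1})$; - the divergence $\delta:C^\infty(S^{r})\to C^\infty(S^{r-1})$, $(\delta f)_{i_1\dots i_{r-1}}=g^{pq}\nabla_p f_{q i_1\dots i_{r-1}}$ (with $\delta=0$ on $S^0$); - the symmetric multiplication by the metric $i:S^r\to S^{r+2}$, $if=\sigma(f\otimes g)$, and the trace $j:S^{r}\to S^{r-2}$, $(jf)_{i_1\dots i_{r-2}}=g^{pq}f_{pq i_1\dots i_{r-2}}$ (with $j=0$ on $S^0$ and $S^1$). A field $f\in C^\infty(S^r)$ is a Killing tensor field if $df=0$, and a potential tensor field if $f=dv$ for some $v\in C^\infty(S^{r-1})$ (so a potential field of rank $0$ is the zero function). Let $\varepsilon\in\{0,1\}$, let $m\ge 0$ be an integer, and let $f\in C^\infty(S^{2m+\varepsilon})$ be a Killing tensor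 field. Then $f$ admits a representation $$f=\sum_{k=0}^m i^{\,m-k}f^k,\qquad f^k\in C^\infty(S^{2k+\varepsilon}),\quad jf^k=0,$$ and in every such representation the divergence $\delta f^k$ is a potential tensor field for every $k=0,\dots,m$. -/

import Mathlib

open scoped Manifold ContDiff

noncomputable section

namespace KillingTensor

/-! ### Multilinear algebra on one vector space -/

section Algebra

variable {𝕜 : Type*} [RCLike 𝕜] {V : Type*} [AddCommGroup V] [Module ℝ V]

/-- The symmetrization `σ`, i.e. the average over all permutations of the arguments. -/
def symmetrize {N : ℕ} (T : MultilinearMap ℝ (fun _ : Fin N => V) 𝕜) :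
    MultilinearMap ℝ (fun _ : Fin N => V) 𝕜 :=
  ((N.factorial : ℝ)⁻¹) • ∑ π : Equiv.Perm (Fin N), T.domDomCongr π

/-- The tensor product `T ⊗ B` of a rank `N` covariant tensor `T` and a bilinear form `B`. -/
def tensorBilin {N : ℕ} (T : MultilinearMap ℝ (fun _ : Fin N => V) 𝕜) (B : V →ₗ[ℝ] V →ₗ[ℝ] ℝ) :
    MultilinearMap ℝ (fun _ : Fin (N + 2) => V) 𝕜 :=
  MultilinearMap.mk'
    (fun w => B (w (Fin.natAdd N 0)) (w (Fin.natAdd N 1)) • T (fun i => w (Fin.castAdd 2 i)))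
    (by
      intro w i u v
      induction i using Fin.addCases with
      | left i =>
        have h : ∀ z : V, (fun j : Fin N => Function.update w (Fin.castAdd 2 i) z (Fin.castAdd 2 j)) =
            Function.update (fun j => w (Fin.castAdd 2 j)) i z := by
          intro z; ext j
          simp [Function.update_apply]
        have h0 : ∀ (z : V) (l : Fin 2), Function.update w (Fin.castAdd 2 i) z (Fin.natAdd N l) =
            w (Fin.natAdd N l) := by
          intro z l
          rw [Function.update_of_ne]
          intro hh
          have := congrArg Fin.val hh
          simp at this; omega
        simp only [h, h0, MultilinearMap.map_update_add, smul_add]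
      | right i =>
        have h : ∀ z : V, (fun j : Fin N => Function.update w (Fin.natAdd N i) z (Fin.castAdd 2 j)) =
            fun j => w (Fin.castAdd 2 j) := by
          intro z; ext j
          rw [Function.update_of_ne]
          intro hh
          have := congrArg Fin.val hh
          simp at this; omega
        simp only [h]
        fin_cases i <;> simp [add_smul])
    (by
      intro w i c u
      induction i using Fin.addCases with
      | left i =>
        have h : ∀ z : V, (fun j : Fin N => Function.update w (Fin.castAdd 2 i) z (Fin.castAdd 2 j)) =
            Function.update (fun j => w (Fin.castAdd 2 j)) i z := by
          intro z; ext j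
          simp [Function.update_apply]
        have h0 : ∀ (z : V) (l : Fin 2), Function.update w (Fin.castAdd 2 i) z (Fin.natAdd N l) =
            w (Fin.natAdd N l) := by
          intro z l
          rw [Function.update_of_ne]
          intro hh
          have := congrArg Fin.val hh
          simp at this; omega
        simp only [h, h0, MultilinearMap.map_update_smul]
        rw [smul_comm]
      | right i =>
        have h : ∀ z : V, (fun j : Fin N => Function.update w (Fin.natAdd N i) z (Fin.castAdd 2 j)) =
            fun j => w (Fin.castAdd 2 j) := by
          intro z; ext j
          rw [Function.update_of_ne]
          intro hh
          have := congrArg Fin.val hh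
          simp at this; omega
        simp only [h]
        fin_cases i <;> simp [mul_smul])

/-- The covariant tensor on `ℝⁿ` with components `c_{a_1 … a_N}` in the standard basis:
`w ↦ ∑ c_{a_1 … a_N} w_1^{a_1} ⋯ w_N^{a_N}`. -/
def ofComponents {n N : ℕ} (c : (Fin N → Fin n) → 𝕜) :
    MultilinearMap ℝ (fun _ : Fin N => EuclideanSpace ℝ (Fin n)) 𝕜 :=
  ∑ a : Fin N → Fin n,
    ((MultilinearMap.mkPiAlgebra ℝ (Fin N) ℝ).compLinearMap
      (fun j => (EuclideanSpace.proj (a j) : EuclideanSpace ℝ (Fin n) →L[ℝ] ℝ).toLinearMap)).smulRight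
        (c a)

end Algebra

/-! ### Tensor fields on a manifold -/

variable (𝕜 : Type*) [RCLike 𝕜] (n : ℕ) (M : Type*) [TopologicalSpace M]
  [ChartedSpace (EuclideanSpace ℝ (Fin n)) M]

/-- Covariant tensor fields of rank `N` on `M` with real or complex values (not necessarily
symmetric or smooth). -/
abbrev TensorField (N : ℕ) : Type _ :=
  ∀ x : M, MultilinearMap ℝ (fun _ : Fin N => TangentSpace (𝓡 n) x) 𝕜

variable {n M}

/-- The coordinate vector `∂/∂x^p` of the chart around `c`, at the point with coordinates `y`. -/
def coordVec (c : M) (y : EuclideanSpace ℝ (Fin n)) (p : Fin n) :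
    TangentSpace (𝓡 n) ((extChartAt (𝓡 n) c).symm y) :=
  mfderiv 𝓘(ℝ, EuclideanSpace ℝ (Fin n)) (𝓡 n) (extChartAt (𝓡 n) c).symm y
    (EuclideanSpace.single p (1 : ℝ) : EuclideanSpace ℝ (Fin n))

/-- The partial derivative `∂F/∂x^p` of a function of the coordinates. -/
def partialDeriv {W : Type*} [NormedAddCommGroup W] [NormedSpace ℝ W]
    (F : EuclideanSpace ℝ (Fin n) → W) (y : EuclideanSpace ℝ (Fin n)) (p : Fin n) : W :=
  fderiv ℝ F y (EuclideanSpace.single p (1 : ℝ))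

variable {𝕜}

/-- The components `f_{a_1 … a_N}` of a tensor field in the chart around `c`. -/
def components {N : ℕ} (f : TensorField 𝕜 n M N) (c : M) (y : EuclideanSpace ℝ (Fin n))
    (a : Fin N → Fin n) : 𝕜 :=
  f ((extChartAt (𝓡 n) c).symm y) (fun j => coordVec c y (a j))

/-- `f ∈ C^∞(S^N)`: `f` is symmetric and all its components in charts are smooth. -/
structure IsSmoothSymmetric {N : ℕ} (f : TensorField 𝕜 n M N) : Prop where
  symm : ∀ (x : M) (π : Equiv.Perm (Fin N)), (f x).domDomCongr π = f x
  smooth : ∀ (c : M) (a : Fin N → Fin n),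
    ContDiffOn ℝ ∞ (fun y => components f c y a) (extChartAt (𝓡 n) c).target

/-- Renaming the rank of a tensor field along an equality. -/
def castRank {N N' : ℕ} (h : N = N') (f : TensorField 𝕜 n M N) : TensorField 𝕜 n M N' :=
  fun x => (f x).domDomCongr (finCongr h)

variable [IsManifold (𝓡 n) ∞ M]
  (g : Bundle.ContMDiffRiemannianMetric (𝓡 n) ∞ (EuclideanSpace ℝ (Fin n))
    (fun x : M => TangentSpace (𝓡 n) x))

/-- The metric at `x` as a bilinear form on `T_xM`. -/
def metricForm (x : M) : TangentSpace (𝓡 n) x →ₗ[ℝ] TangentSpace (𝓡 n) x →ₗ[ℝ] ℝ :=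
  LinearMap.mk₂ ℝ (fun u v => g.inner x u v) (by simp) (by simp) (by simp) (by simp)

/-- The components `g_{pq}` of the metric in the chart around `c`. -/
def metricMatrix (c : M) (y : EuclideanSpace ℝ (Fin n)) : Matrix (Fin n) (Fin n) ℝ :=
  Matrix.of fun p q => metricForm g ((extChartAt (𝓡 n) c).symm y) (coordVec c y p) (coordVec c y q)

/-- The Christoffel symbols `Γ^q_{pr}` of the Levi-Civita connection in the chart around `c`. -/
def christoffel (c : M) (y : EuclideanSpace ℝ (Fin n)) (q p r : Fin n) : ℝ :=
  (1 / 2 : ℝ) * ∑ l : Fin n, (metricMatrix g c y)⁻¹ q l *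
    (partialDeriv (fun z => metricMatrix g c z r l) y p
      + partialDeriv (fun z => metricMatrix g c z p l) y r
      - partialDeriv (fun z => metricMatrix g c z p r) y l)

/-- The components of the covariant derivative in the chart around `c`:
`∇_p f_{a_1 … a_N} = ∂_p f_{a_1 … a_N} - ∑_k ∑_q Γ^q_{p a_k} f_{a_1 … q … a_N}`. -/
def covDerivComponents {N : ℕ} (f : TensorField 𝕜 n M N) (c : M) (y : EuclideanSpace ℝ (Fin n))
    (p : Fin n) (a : Fin N → Fin n) : 𝕜 :=
  partialDeriv (fun z => components f c z a) y p
    - ∑ k : Fin N, ∑ q : Fin n,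
        christoffel g c y q p (a k) • components f c y (Function.update a k q)

/-- The covariant derivative `∇f` of rank `N + 1`; the first argument is the direction of
differentiation. At the point `x` it is computed in the preferred chart around `x`; the coordinate
vectors of this chart at `x` are the standard basis of `T_xM = ℝⁿ`. -/
def covDeriv {N : ℕ} (f : TensorField 𝕜 n M N) : TensorField 𝕜 n M (N + 1) := fun x =>
  (ofComponents fun a : Fin (N + 1) → Fin n =>
    covDerivComponents g f x (extChartAt (𝓡 n) x x) (a 0) (fun j => a j.succ) :
    MultilinearMap ℝ (fun _ : Fin (N + 1) => EuclideanSpace ℝ (Fin n)) 𝕜)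

/-- The inner differentiation `d = σ∇ : C^∞(S^N) → C^∞(S^{N+1})`. -/
def innerDiff {N : ℕ} (f : TensorField 𝕜 n M N) : TensorField 𝕜 n M (N + 1) :=
  fun x => symmetrize (covDeriv g f x)

/-- The standard basis vector of `T_xM = ℝⁿ`. -/
def tangentBasis (x : M) (p : Fin n) : TangentSpace (𝓡 n) x :=
  (EuclideanSpace.single p (1 : ℝ) : EuclideanSpace ℝ (Fin n))

/-- The Gram matrix `g_{pq}` of the metric at `x` in the standard basis of `T_xM = ℝⁿ`. -/
def gram (x : M) : Matrix (Fin n) (Fin n) ℝ :=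
  Matrix.of fun p q => metricForm g x (tangentBasis x p) (tangentBasis x q)

/-- The contraction of the first two arguments with the metric,
`(jf)_{a_1 … a_N} = g^{pq} f_{p q a_1 … a_N}`. -/
def trace {N : ℕ} (f : TensorField 𝕜 n M (N + 2)) : TensorField 𝕜 n M N := fun x =>
  ∑ p : Fin n, ∑ q : Fin n,
    (gram g x)⁻¹ p q • ((f x).curryLeft (tangentBasis x p)).curryLeft (tangentBasis x q)

/-- The divergence `(δf)_{a_1 … a_N} = g^{pq} ∇_p f_{q a_1 … a_N}`, with `δ = 0` in rank `0`. -/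
def divergence : {N : ℕ} → TensorField 𝕜 n M N → TensorField 𝕜 n M (N - 1)
  | 0, _ => 0
  | _ + 1, f => trace g (covDeriv g f)

/-- `jf = 0`, which is no condition for tensors of rank `0` and `1`. -/
def IsTraceFree : {N : ℕ} → TensorField 𝕜 n M N → Prop
  | 0, _ => True
  | 1, _ => True
  | _ + 2, f => trace g f = 0

/-- The symmetric multiplication by the metric, `if = σ(f ⊗ g)`. -/
def mulMetric {N : ℕ} (f : TensorField 𝕜 n M N) : TensorField 𝕜 n M (N + 2) :=
  fun x => symmetrize (tensorBilin (f x) (metricForm g x))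

/-- The iterate `i^s` of the symmetric multiplication by the metric. -/
def mulMetricPow {N : ℕ} (f : TensorField 𝕜 n M N) : (s : ℕ) → TensorField 𝕜 n M (N + 2 * s)
  | 0 => f
  | s + 1 => mulMetric g (mulMetricPow f s)

/-- `f` is a Killing tensor field: `f ∈ C^∞(S^N)` and `df = 0`. -/
structure IsKilling {N : ℕ} (f : TensorField 𝕜 n M N) : Prop where
  smoothSymmetric : IsSmoothSymmetric f
  innerDiff_eq_zero : innerDiff g f = 0

/-- `f` is a potential tensor field: `f = dv` for some `v ∈ C^∞(S^{N-1})`. As `S^{-1} = 0`,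
a potential field of rank `0` is the zero function. -/
def IsPotential : {N : ℕ} → TensorField 𝕜 n M N → Prop
  | 0, f => f = 0
  | N + 1, f => ∃ v : TensorField 𝕜 n M N, IsSmoothSymmetric v ∧ f = innerDiff g v

/-- `f = ∑_{k=0}^m i^{m-k} f^k` with `f^k ∈ C^∞(Ker^{ε+2k} j)`, for a field `f` of rank `ε + 2m`;
here `ε ∈ {0, 1}` is the parity of the rank. -/
structure IsHarmonicExpansion {ε m : ℕ} (f : TensorField 𝕜 n M (ε + 2 * m))
    (h : ∀ k : Fin (m + 1), TensorField 𝕜 n M (ε + 2 * (k : ℕ))) : Prop where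
  smoothSymmetric : ∀ k, IsSmoothSymmetric (h k)
  traceFree : ∀ k, IsTraceFree g (h k)
  eq_sum : f = ∑ k : Fin (m + 1),
    castRank (by have := k.isLt; omega) (mulMetricPow g (h k) (m - (k : ℕ)))

end KillingTensor

end

/-! A symmetric tensor at a point is the same thing as a homogeneous polynomial on the tangent
space. In this dictionary the multiplication `i` becomes multiplication by the quadratic form `Q` of
the metric, the trace `j` becomes the Laplacian of the metric up to a positive integer factor, and
`df` becomes `∑ X_p ∇_p f`. Since `∇g = 0`, `d` commutes with `i`, and `∇_p` preserves harmonicity,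
i.e. trace-freeness.

Existence of the expansion is the classical decomposition of a polynomial into powers of `Q` times
harmonics (`exists_polyAt_expansion`). It rests on the formula for the Laplacian of `Q^(s+1) P` with
`P` harmonic (`lap_quad_pow_mul`), which also gives uniqueness (`eq_zero_of_sum_quad_pow_mul`).

For the divergences, let `f^k` have rank `r_k = ε + 2k`. As `f^k` is trace-free, the Laplacian of `d
f^k` is `2 r_k δf^k`, and `δf^k` is itself harmonic. If `n > 0`, it follows that `d f^k = H_k + c_k
Q δf^k` with `H_k` harmonic and `c_k = r_k / (n + 2(r_k - 1))`. Insert this into `0 = df = ∑ Q^(m-k)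
d f^k` and compare the harmonic coefficients of each power of `Q` (`harmonic_parts_of_sum_eq_zero`):
the top power gives `δf^0 = 0`, and the power `m - k` gives `H_k + c_(k+1) δf^(k+1) = 0` for `k <
m`.

Hence `c_(k+1) δf^(k+1) = c_k Q δf^k - d f^k`. If `δf^k = dv`, then `Q δf^k = d(iv)`, so `δf^(k+1)`
is again of the form `d(…)`; induction on `k` finishes the proof (`exists_potential`). In dimension
zero every divergence is an empty sum. -/

noncomputable section

namespace KillingTensor

/-! ### Symmetric arrays and homogeneous polynomials -/

section Arrays

open MvPolynomial

variable {n N : ℕ}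

/-- An array of components which is invariant under permutations of the indices. -/
def IsSymmArray {K : Type*} (c : (Fin N → Fin n) → K) : Prop :=
  ∀ (π : Equiv.Perm (Fin N)) (a : Fin N → Fin n), c (a ∘ π) = c a

theorem IsSymmArray.cons {K : Type*} {c : (Fin (N + 1) → Fin n) → K} (hc : IsSymmArray c)
    (p : Fin n) : IsSymmArray fun a => c (Fin.cons p a) := by
  intro π a
  change c (Fin.cons p (a ∘ π)) = c (Fin.cons p a)
  rw [← hc (Equiv.Perm.decomposeFin.symm (0, π)) (Fin.cons p a)]
  congr 1
  ext j
  refine Fin.cases ?_ (fun j => ?_) j <;> simp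

theorem IsSymmArray.swap {K : Type*} {c : (Fin (N + 2) → Fin n) → K} (hc : IsSymmArray c)
    (p q : Fin n) (a : Fin N → Fin n) :
    c (Fin.cons p (Fin.cons q a)) = c (Fin.cons q (Fin.cons p a)) := by
  rw [← hc (Equiv.swap 0 (Fin.succ 0)) (Fin.cons p (Fin.cons q a))]
  congr 1
  ext j
  refine Fin.cases ?_ (fun j => ?_) j
  · rw [Function.comp_apply, Equiv.swap_apply_left]
    rfl
  · refine Fin.cases ?_ (fun j => ?_) j
    · rw [Function.comp_apply, Equiv.swap_apply_right]
      rfl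
    · rw [Function.comp_apply, Equiv.swap_apply_of_ne_of_ne (Fin.succ_ne_zero _)
        ((Fin.succ_injective _).ne (Fin.succ_ne_zero _))]
      rfl

variable {K : Type*} [Field K]

/-- The homogeneous polynomial `∑ c_{a_1 … a_N} X_{a_1} ⋯ X_{a_N}` of an array of components. -/
def toPoly : ((Fin N → Fin n) → K) →ₗ[K] MvPolynomial (Fin n) K where
  toFun c := ∑ a, C (c a) * ∏ j, X (a j)
  map_add' c c' := by simp [add_mul, Finset.sum_add_distrib]
  map_smul' r c := by simp [smul_eq_C_mul, Finset.mul_sum, mul_assoc]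

theorem toPoly_apply (c : (Fin N → Fin n) → K) :
    toPoly c = ∑ a, C (c a) * ∏ j, X (a j) := rfl

theorem toPoly_isHomogeneous (c : (Fin N → Fin n) → K) : (toPoly c).IsHomogeneous N := by
  refine IsHomogeneous.sum _ _ _ fun a _ => ?_
  have h := (isHomogeneous_C (Fin n) (c a)).mul
    (IsHomogeneous.prod Finset.univ (fun j => (X (a j) : MvPolynomial (Fin n) K))
      (fun _ => 1) fun j _ => isHomogeneous_X _ _)
  simpa using h

theorem toPoly_comp_perm (c : (Fin N → Fin n) → K) (π : Equiv.Perm (Fin N)) :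
    toPoly (fun a => c (a ∘ π)) = toPoly c := by
  simp only [toPoly_apply]
  refine Fintype.sum_equiv (Equiv.arrowCongr π.symm (Equiv.refl _)) _ _ fun a => ?_
  congr 1
  simpa using (Equiv.prod_comp π fun j => (X (a j) : MvPolynomial (Fin n) K)).symm

theorem toPoly_rank_zero (c : (Fin 0 → Fin n) → K) : toPoly c = C (c default) := by
  simp [toPoly_apply]

theorem toPoly_cons (c : (Fin (N + 1) → Fin n) → K) :
    toPoly c = ∑ p, X p * toPoly (fun a => c (Fin.cons p a)) := by
  simp only [toPoly_apply]
  rw [← (Fin.consEquiv fun _ => Fin n).sum_comp, Fintype.sum_prod_type]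
  refine Finset.sum_congr rfl fun p _ => ?_
  rw [Finset.mul_sum]
  refine Finset.sum_congr rfl fun a _ => ?_
  simp only [Fin.consEquiv, Equiv.coe_fn_mk, Fin.prod_univ_succ, Fin.cons_zero, Fin.cons_succ]
  ring

theorem pderiv_toPoly_rank_zero (c : (Fin 0 → Fin n) → K) (p : Fin n) :
    pderiv p (toPoly c) = 0 := by
  simp [toPoly_rank_zero]

/-- By symmetry each of the `N + 1` index slots contributes equally. This turns contractions of
arrays into differential operators on polynomials. -/
theorem pderiv_toPoly {c : (Fin (N + 1) → Fin n) → K} (hc : IsSymmArray c) (p : Fin n) :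
    pderiv p (toPoly c) = ((N + 1 : ℕ) : MvPolynomial (Fin n) K) *
      toPoly (fun a => c (Fin.cons p a)) := by
  induction N with
  | zero =>
    rw [toPoly_cons, map_sum]
    simp [pderiv_toPoly_rank_zero, pderiv_X, Pi.single_apply]
  | succ N ih =>
    have h : ∀ q, pderiv p (X q * toPoly (fun a => c (Fin.cons q a))) =
        (if q = p then toPoly (fun a => c (Fin.cons q a)) else 0) +
          ((N + 1 : ℕ) : MvPolynomial (Fin n) K) *
            (X q * toPoly (fun a => c (Fin.cons p (Fin.cons q a)))) := by
      intro q
      rw [Derivation.leibniz, ih (hc.cons q), pderiv_X, Pi.single_apply]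
      simp only [hc.swap q p, smul_eq_mul]
      split_ifs <;> ring
    rw [toPoly_cons, map_sum, Finset.sum_congr rfl fun q _ => h q, Finset.sum_add_distrib,
      ← Finset.mul_sum, ← toPoly_cons fun a => c (Fin.cons p a)]
    simp only [Finset.sum_ite_eq', Finset.mem_univ, if_true]
    push_cast
    ring

/-- Polarization by differentiation: each partial derivative recovers the array with its first index
fixed, up to a factor invertible in characteristic zero, so induction on the rank applies. -/
theorem IsSymmArray.eq_zero_of_toPoly [CharZero K] {c : (Fin N → Fin n) → K} (hc : IsSymmArray c)
    (h : toPoly c = 0) : c = 0 := by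
  induction N with
  | zero =>
    rw [toPoly_rank_zero, C_eq_zero] at h
    ext a
    rw [Subsingleton.elim a default, h, Pi.zero_apply]
  | succ N ih =>
    ext a
    have h' := pderiv_toPoly hc (a 0)
    rw [h, map_zero, eq_comm, mul_eq_zero, or_iff_right (Nat.cast_ne_zero.2 N.succ_ne_zero)] at h'
    have := congrFun (ih (hc.cons _) h') (Fin.tail a)
    simpa [Fin.cons_self_tail] using this

theorem IsSymmArray.ext [CharZero K] {c c' : (Fin N → Fin n) → K} (hc : IsSymmArray c)
    (hc' : IsSymmArray c') (h : toPoly c = toPoly c') : c = c' := by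
  refine sub_eq_zero.1 (IsSymmArray.eq_zero_of_toPoly (fun π a => ?_) (by simp [h]))
  simp [hc π a, hc' π a]

/-- The quadratic form of a matrix, as a polynomial. -/
def quad : Matrix (Fin n) (Fin n) K →ₗ[K] MvPolynomial (Fin n) K where
  toFun B := ∑ p, ∑ q, C (B p q) * (X p * X q)
  map_add' B B' := by simp [add_mul, Finset.sum_add_distrib]
  map_smul' r B := by simp [smul_eq_C_mul, Finset.mul_sum, mul_assoc]

theorem quad_apply (B : Matrix (Fin n) (Fin n) K) :
    quad B = ∑ p, ∑ q, C (B p q) * (X p * X q) := rfl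

theorem toPoly_tensor (c : (Fin N → Fin n) → K) (B : Matrix (Fin n) (Fin n) K) :
    toPoly (fun a : Fin (N + 2) → Fin n =>
      B (a (Fin.natAdd N 0)) (a (Fin.natAdd N 1)) * c (fun j => a (Fin.castAdd 2 j))) =
      quad B * toPoly c := by
  simp only [toPoly_apply, quad_apply]
  rw [← (Fin.appendEquiv N 2).sum_comp, Fintype.sum_prod_type_right, Finset.sum_mul,
    ← (finTwoArrowEquiv (Fin n)).symm.sum_comp, Fintype.sum_prod_type]
  refine Finset.sum_congr rfl fun p _ => ?_
  rw [Finset.sum_mul]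
  refine Finset.sum_congr rfl fun q _ => ?_
  rw [Finset.mul_sum]
  refine Finset.sum_congr rfl fun a _ => ?_
  simp only [Fin.appendEquiv, Equiv.coe_fn_mk, Fin.append_left, Fin.append_right,
    Fin.prod_univ_add, Fin.prod_univ_two, C_mul]
  change C (B p q) * C (c fun j => a j) * ((∏ i, X (a i)) * (X p * X q)) = _
  ring

/-- The second order operator `∑ B_{pq} ∂_p ∂_q` on polynomials. -/
def lap (B : Matrix (Fin n) (Fin n) K) : MvPolynomial (Fin n) K →ₗ[K] MvPolynomial (Fin n) K where
  toFun P := ∑ p, ∑ q, C (B p q) * pderiv p (pderiv q P)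
  map_add' P P' := by simp [mul_add, Finset.sum_add_distrib]
  map_smul' r P := by simp [smul_eq_C_mul, Finset.mul_sum, mul_left_comm]

theorem lap_apply (B : Matrix (Fin n) (Fin n) K) (P : MvPolynomial (Fin n) K) :
    lap B P = ∑ p, ∑ q, C (B p q) * pderiv p (pderiv q P) := rfl

theorem toPoly_trace {c : (Fin (N + 2) → Fin n) → K} (hc : IsSymmArray c)
    (B : Matrix (Fin n) (Fin n) K) :
    (((N + 2) * (N + 1) : ℕ) : MvPolynomial (Fin n) K) *
      toPoly (fun a => ∑ p, ∑ q, B p q * c (Fin.cons p (Fin.cons q a))) = lap B (toPoly c) := by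
  have : (fun a => ∑ p, ∑ q, B p q * c (Fin.cons p (Fin.cons q a))) =
      ∑ p, ∑ q, B p q • fun a => c (Fin.cons p (Fin.cons q a)) := by
    ext a; simp [Finset.sum_apply]
  rw [this, lap_apply]
  simp only [map_sum, map_smul, Finset.mul_sum]
  refine Finset.sum_congr rfl fun p _ => Finset.sum_congr rfl fun q _ => ?_
  rw [pderiv_toPoly hc, Derivation.leibniz, Derivation.map_natCast, pderiv_toPoly (hc.cons q)]
  simp only [hc.swap q p, smul_eq_C_mul, smul_eq_mul]
  push_cast
  ring

/-- Intended for `c p` the components of `∇_p f`. No symmetry between `p` and the other indices is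
available, so only one of the two contracted indices becomes a derivative. -/
theorem toPoly_divergence {c : Fin n → (Fin (N + 1) → Fin n) → K} (hc : ∀ p, IsSymmArray (c p))
    (B : Matrix (Fin n) (Fin n) K) :
    ((N + 1 : ℕ) : MvPolynomial (Fin n) K) *
      toPoly (fun a => ∑ p, ∑ q, B p q * c p (Fin.cons q a)) =
      ∑ p, ∑ q, C (B p q) * pderiv q (toPoly (c p)) := by
  have : (fun a => ∑ p, ∑ q, B p q * c p (Fin.cons q a)) =
      ∑ p, ∑ q, B p q • fun a => c p (Fin.cons q a) := by
    ext a; simp [Finset.sum_apply]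
  rw [this]
  simp only [map_sum, map_smul, Finset.mul_sum]
  refine Finset.sum_congr rfl fun p _ => Finset.sum_congr rfl fun q _ => ?_
  rw [pderiv_toPoly (hc p), smul_eq_C_mul]
  ring

/-- The derivation of polynomials with `X_q ↦ ∑ Γ_{qr} X_r`. -/
def connDer (Γ : Matrix (Fin n) (Fin n) K) :
    Derivation K (MvPolynomial (Fin n) K) (MvPolynomial (Fin n) K) :=
  mkDerivation K fun q => ∑ r, C (Γ q r) * X r

theorem connDer_X (Γ : Matrix (Fin n) (Fin n) K) (q : Fin n) :
    connDer Γ (X q) = ∑ r, C (Γ q r) * X r := mkDerivation_X _ _ _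

theorem connDer_C (Γ : Matrix (Fin n) (Fin n) K) (r : K) : connDer Γ (C r) = 0 :=
  mkDerivationₗ_C _ _

/-- The Christoffel correction replaces one index at a time, which is the Leibniz rule of a
derivation acting linearly on the variables. -/
theorem toPoly_connDer (c : (Fin N → Fin n) → K) (Γ : Matrix (Fin n) (Fin n) K) :
    toPoly (fun a => ∑ k, ∑ q, Γ q (a k) * c (Function.update a k q)) = connDer Γ (toPoly c) := by
  induction N with
  | zero => rw [toPoly_rank_zero, toPoly_rank_zero, connDer_C]; simp
  | succ N ih =>
    rw [toPoly_cons, toPoly_cons c, map_sum]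
    have h : ∀ s, (fun a : Fin N → Fin n => ∑ k, ∑ q, Γ q ((Fin.cons s a : Fin (N + 1) → Fin n) k) *
        c (Function.update (Fin.cons s a) k q)) =
        (∑ q, Γ q s • fun a => c (Fin.cons q a)) +
          fun a => ∑ k, ∑ q, Γ q (a k) * c (Fin.cons s (Function.update a k q)) := by
      intro s
      ext a
      rw [Fin.sum_univ_succ]
      simp [Finset.sum_apply, Fin.cons_update]
    have h' : ∀ s, toPoly (fun a => c (Fin.cons s a)) * connDer Γ (X s) =
        ∑ q, X q * (C (Γ s q) * toPoly (fun a => c (Fin.cons s a))) := by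
      intro s
      rw [connDer_X, Finset.mul_sum]
      exact Finset.sum_congr rfl fun q _ => by ring
    simp only [h, map_add, Derivation.leibniz, smul_eq_mul, h', mul_add, Finset.sum_add_distrib,
      map_sum, map_smul, smul_eq_C_mul, Finset.mul_sum]
    rw [add_comm, Finset.sum_comm]
    refine congrArg₂ (· + ·) (Finset.sum_congr rfl fun s _ => ?_) rfl
    rw [ih fun a => c (Fin.cons s a)]

theorem sum_sum_sum_rev {R : Type*} [AddCommMonoid R] (F : Fin n → Fin n → Fin n → R) :
    ∑ p, ∑ q, ∑ r, F p q r = ∑ r, ∑ q, ∑ p, F p q r := by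
  rw [Finset.sum_congr rfl fun p _ => Finset.sum_comm, Finset.sum_comm]
  exact Finset.sum_congr rfl fun p _ => Finset.sum_comm

theorem derivation_sum_apply {ι : Type*} (s : Finset ι)
    (D : ι → Derivation K (MvPolynomial (Fin n) K) (MvPolynomial (Fin n) K))
    (P : MvPolynomial (Fin n) K) : (∑ i ∈ s, D i) P = ∑ i ∈ s, D i P := by
  induction s using Finset.cons_induction with
  | empty => simp
  | cons i s hi ih => simp [Finset.sum_cons, ih]

/-- For `B` the metric and `Γ` the connection, the matrix on the right is the partial derivative of
the metric; this is how `∇g = 0` enters. -/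
theorem connDer_quad (Γ B : Matrix (Fin n) (Fin n) K) :
    connDer Γ (quad B) = quad (Γ.transpose * B + B * Γ) := by
  have h : ∀ p q, connDer Γ (C (B p q) * (X p * X q)) =
      ∑ r, C (Γ p r) * C (B p q) * (X r * X q) + ∑ r, C (B p q) * C (Γ q r) * (X p * X r) := by
    intro p q
    simp only [Derivation.leibniz, connDer_X, connDer_C, smul_eq_mul, mul_zero, add_zero, mul_add,
      Finset.mul_sum]
    rw [add_comm]
    congr 1 <;> exact Finset.sum_congr rfl fun r _ => by ring
  rw [map_add]
  simp only [quad_apply, map_sum, h, Finset.sum_add_distrib, Matrix.mul_apply,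
    Matrix.transpose_apply, C_mul, Finset.sum_mul]
  exact congrArg₂ (· + ·) (sum_sum_sum_rev fun p q r => C (Γ p r) * C (B p q) * (X r * X q))
    (Finset.sum_congr rfl fun p _ => Finset.sum_comm)

theorem pderiv_comm (p q : Fin n) (P : MvPolynomial (Fin n) K) :
    pderiv p (pderiv q P) = pderiv q (pderiv p P) := by
  have : ⁅(pderiv p : Derivation K (MvPolynomial (Fin n) K) _), pderiv q⁆ = 0 :=
    derivation_ext fun i => by
      rw [Derivation.commutator_apply, pderiv_X, pderiv_X, Pi.single_apply, Pi.single_apply]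
      split_ifs <;> simp
  have := congrArg (fun D : Derivation K (MvPolynomial (Fin n) K) _ => D P) this
  exact sub_eq_zero.1 (by simpa only [Derivation.commutator_apply, Derivation.zero_apply] using this)

/-- The commutator of two derivations is a derivation, so it suffices to compare values on the
variables. -/
theorem pderiv_connDer (Γ : Matrix (Fin n) (Fin n) K) (p : Fin n) (P : MvPolynomial (Fin n) K) :
    pderiv p (connDer Γ P) = connDer Γ (pderiv p P) + ∑ q, C (Γ q p) * pderiv q P := by
  have : ⁅(pderiv p : Derivation K (MvPolynomial (Fin n) K) _), connDer Γ⁆ =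
      ∑ q, Γ q p • (pderiv q : Derivation K (MvPolynomial (Fin n) K) _) :=
    derivation_ext fun i => by
      simp [Derivation.commutator_apply, connDer_X, pderiv_X, Pi.single_apply, apply_ite,
        smul_eq_C_mul, Derivation.leibniz, derivation_sum_apply]
  have := congrArg (fun D : Derivation K (MvPolynomial (Fin n) K) _ => D P) this
  rw [← sub_eq_iff_eq_add']
  simpa [Derivation.commutator_apply, derivation_sum_apply, smul_eq_C_mul] using this

/-- For `G` the inverse metric and `Γ` the connection, the matrix in the extra term is minus the
partial derivative of `G`. The term therefore cancels when the trace is differentiated covariantly.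
-/
theorem lap_connDer (G Γ : Matrix (Fin n) (Fin n) K) (P : MvPolynomial (Fin n) K) :
    lap G (connDer Γ P) = connDer Γ (lap G P) + lap (Γ * G + G * Γ.transpose) P := by
  have h : ∀ p q, C (G p q) * pderiv p (pderiv q (connDer Γ P)) =
      connDer Γ (C (G p q) * pderiv p (pderiv q P)) +
        ∑ r, C (Γ r p) * C (G p q) * pderiv r (pderiv q P) +
        ∑ r, C (G p q) * C (Γ r q) * pderiv p (pderiv r P) := by
    intro p q
    have h' : ∀ a r, pderiv p (C (Γ a r) * pderiv a P) = C (Γ a r) * pderiv p (pderiv a P) := by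
      intro a r
      rw [Derivation.leibniz, pderiv_C, smul_zero, add_zero, smul_eq_mul]
    rw [pderiv_connDer, map_add, pderiv_connDer, map_sum, Derivation.leibniz, connDer_C, smul_zero,
      add_zero, smul_eq_mul, mul_add, mul_add, Finset.mul_sum, Finset.mul_sum]
    simp only [h']
    refine congrArg₂ (· + ·) (congrArg₂ (· + ·) rfl ?_) ?_ <;>
      exact Finset.sum_congr rfl fun r _ => by ring
  simp only [lap_apply, h, Finset.sum_add_distrib, map_sum, Matrix.add_apply, C_add, add_mul,
    Matrix.mul_apply, Matrix.transpose_apply, C_mul, Finset.sum_mul, add_assoc]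
  exact congrArg₂ (· + ·) rfl (congrArg₂ (· + ·)
    (sum_sum_sum_rev fun p q r => C (Γ r p) * C (G p q) * pderiv r (pderiv q P))
    (Finset.sum_congr rfl fun p _ => Finset.sum_comm))

theorem pderiv_lap (G : Matrix (Fin n) (Fin n) K) (r : Fin n)
    (P : MvPolynomial (Fin n) K) : pderiv r (lap G P) = lap G (pderiv r P) := by
  simp only [lap_apply, map_sum]
  refine Finset.sum_congr rfl fun p _ => Finset.sum_congr rfl fun q _ => ?_
  rw [Derivation.leibniz, pderiv_C, smul_zero, add_zero, smul_eq_mul, pderiv_comm r p,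
    pderiv_comm r q]

theorem lap_neg (G : Matrix (Fin n) (Fin n) K)
    (P : MvPolynomial (Fin n) K) : lap (-G) P = -lap G P := by
  simp [lap_apply]

theorem lap_toPoly_rank_zero (G : Matrix (Fin n) (Fin n) K)
    (c : (Fin 0 → Fin n) → K) : lap G (toPoly c) = 0 := by
  simp [lap_apply, pderiv_toPoly_rank_zero]

theorem lap_toPoly_rank_one (G : Matrix (Fin n) (Fin n) K)
    (c : (Fin 1 → Fin n) → K) : lap G (toPoly c) = 0 := by
  have hc : IsSymmArray c := fun π a => by rw [Subsingleton.elim π 1]; rfl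
  rw [lap_apply]
  refine Finset.sum_eq_zero fun p _ => Finset.sum_eq_zero fun q _ => ?_
  rw [pderiv_toPoly hc, Derivation.leibniz, pderiv_toPoly_rank_zero, Derivation.map_natCast,
    smul_zero, smul_zero, add_zero, mul_zero]

theorem lap_X_mul {G : Matrix (Fin n) (Fin n) K} (hG : G.IsSymm) (r : Fin n)
    (P : MvPolynomial (Fin n) K) :
    lap G (X r * P) = X r * lap G P + 2 * ∑ q, C (G r q) * pderiv q P := by
  have h : ∀ p q, C (G p q) * pderiv p (pderiv q (X r * P)) =
      X r * (C (G p q) * pderiv p (pderiv q P)) +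
        (if r = p then C (G p q) * pderiv q P else 0) +
        (if r = q then C (G p q) * pderiv p P else 0) := by
    intro p q
    simp only [Derivation.leibniz, map_add, pderiv_X, Pi.single_apply, smul_eq_mul]
    split_ifs <;> simp <;> ring
  simp only [lap_apply, h, Finset.sum_add_distrib, Finset.sum_ite_eq, Finset.mem_univ, if_true,
    Finset.sum_ite_irrel, Finset.sum_const_zero, Finset.mul_sum]
  rw [add_assoc, ← Finset.mul_sum]
  simp only [hG.apply r, ← two_mul]

theorem pderiv_quad {B : Matrix (Fin n) (Fin n) K} (hB : B.IsSymm) (p : Fin n) :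
    pderiv p (quad B) = 2 * ∑ q, C (B p q) * X q := by
  have h : ∀ a b, pderiv p (C (B a b) * (X a * X b)) =
      (if a = p then C (B a b) * X b else 0) + (if b = p then C (B a b) * X a else 0) := by
    intro a b
    simp only [Derivation.leibniz, pderiv_X, pderiv_C, Pi.single_apply, smul_eq_mul]
    split_ifs <;> simp only [mul_one, mul_zero, add_zero, zero_add] <;> ring
  simp only [quad_apply, map_sum, h, Finset.sum_add_distrib, Finset.sum_ite_eq', Finset.mem_univ,
    if_true, Finset.sum_ite_irrel, Finset.sum_const_zero]
  simp only [hB.apply p, ← two_mul]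

theorem lap_mul {G : Matrix (Fin n) (Fin n) K} (hG : G.IsSymm) (P R : MvPolynomial (Fin n) K) :
    lap G (P * R) = lap G P * R + P * lap G R +
      2 * ∑ q, (∑ p, C (G q p) * pderiv p P) * pderiv q R := by
  have h : ∀ p q, C (G p q) * pderiv p (pderiv q (P * R)) =
      C (G p q) * pderiv p (pderiv q P) * R + P * (C (G p q) * pderiv p (pderiv q R)) +
        (C (G p q) * pderiv q P * pderiv p R + C (G p q) * pderiv p P * pderiv q R) := by
    intro p q
    simp only [Derivation.leibniz, map_add, smul_eq_mul]
    ring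
  simp only [lap_apply, h, Finset.sum_add_distrib, Finset.sum_mul, Finset.mul_sum, two_mul]
  refine congrArg₂ (· + ·) rfl (congrArg₂ (· + ·) ?_ ?_)
  · exact Finset.sum_congr rfl fun p _ => Finset.sum_congr rfl fun q _ => by ring
  · rw [Finset.sum_comm]
    exact Finset.sum_congr rfl fun q _ => Finset.sum_congr rfl fun p _ => by rw [hG.apply p q]

/-! ### Laplacian against multiplication by the quadratic form, and harmonic expansions -/

variable {G B : Matrix (Fin n) (Fin n) K}

theorem sum_pderiv_quad (hB : B.IsSymm) (hGB : G * B = 1) (q : Fin n) :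
    ∑ p, C (G q p) * pderiv p (quad B) = 2 * X q := by
  simp only [pderiv_quad hB, Finset.mul_sum]
  rw [Finset.sum_comm]
  have h : ∀ b, ∑ p, C (G q p) * (2 * (C (B p b) * X b)) =
      2 * (C ((1 : Matrix (Fin n) (Fin n) K) q b) * X b) := by
    intro b
    rw [← hGB, Matrix.mul_apply, map_sum, Finset.sum_mul, Finset.mul_sum]
    exact Finset.sum_congr rfl fun p _ => by rw [C_mul]; ring
  simp [h, Matrix.one_apply, apply_ite]

theorem lap_quad (hB : B.IsSymm) (hGB : G * B = 1) :
    lap G (quad B) = 2 * (n : MvPolynomial (Fin n) K) := by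
  have h : ∀ p, ∑ q, C (G p q) * pderiv p (pderiv q (quad B)) = 2 := by
    intro p
    have := congrArg (pderiv p) (sum_pderiv_quad hB hGB p)
    rw [map_sum, Derivation.leibniz, pderiv_X_self,
      show (2 : MvPolynomial (Fin n) K) = C 2 from (map_ofNat C 2).symm, pderiv_C, smul_zero,
      add_zero, smul_eq_mul, mul_one] at this
    rw [show (2 : MvPolynomial (Fin n) K) = C 2 from (map_ofNat C 2).symm, ← this]
    refine Finset.sum_congr rfl fun q _ => ?_
    rw [Derivation.leibniz, pderiv_C, smul_zero, add_zero, smul_eq_mul]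
  simp [lap_apply, h, mul_comm]

/-- The gradient of the quadratic form with respect to `G` is `2X`, so the cross term of the product
rule is `4 ∑ X_q ∂_q P = 4dP` by Euler's identity; `2n` is the Laplacian of the form itself. -/
theorem lap_quad_mul (hB : B.IsSymm) (hG : G.IsSymm) (hGB : G * B = 1) {d : ℕ}
    {P : MvPolynomial (Fin n) K} (hP : P.IsHomogeneous d) :
    lap G (quad B * P) = quad B * lap G P +
      ((2 * n + 4 * d : ℕ) : MvPolynomial (Fin n) K) * P := by
  have h := hP.sum_X_mul_pderiv
  rw [nsmul_eq_mul] at h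
  rw [lap_mul hG, lap_quad hB hGB]
  simp only [sum_pderiv_quad hB hGB, mul_assoc, ← Finset.mul_sum, h]
  push_cast
  ring

theorem quad_isHomogeneous (B : Matrix (Fin n) (Fin n) K) : (quad B).IsHomogeneous 2 := by
  refine IsHomogeneous.sum _ _ _ fun p _ => IsHomogeneous.sum _ _ _ fun q _ => ?_
  exact (isHomogeneous_C _ _).mul ((isHomogeneous_X _ _).mul (isHomogeneous_X _ _))

theorem quad_pow_mul_isHomogeneous (B : Matrix (Fin n) (Fin n) K) {d : ℕ}
    {P : MvPolynomial (Fin n) K} (hP : P.IsHomogeneous d) (s : ℕ) :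
    (quad B ^ s * P).IsHomogeneous (2 * s + d) := ((quad_isHomogeneous B).pow s).mul hP

/-- Iterating `lap_quad_mul`, the constant is the sum of `2n + 4(2t + d)` over `t = 0, …, s`. It is
positive for `n > 0`, which drives both existence and uniqueness of the expansion. -/
theorem lap_quad_pow_mul (hB : B.IsSymm) (hG : G.IsSymm) (hGB : G * B = 1) {d : ℕ}
    {P : MvPolynomial (Fin n) K} (hP : P.IsHomogeneous d) (h0 : lap G P = 0) (s : ℕ) :
    lap G (quad B ^ (s + 1) * P) =
      ((2 * (s + 1) * (n + 2 * d + 2 * s) : ℕ) : MvPolynomial (Fin n) K) * (quad B ^ s * P) := by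
  induction s with
  | zero =>
    rw [zero_add, pow_one, lap_quad_mul hB hG hGB hP, h0]
    push_cast
    ring
  | succ s ih =>
    rw [pow_succ', mul_assoc, lap_quad_mul hB hG hGB (quad_pow_mul_isHomogeneous B hP _), ih]
    push_cast
    ring

/-- Uniqueness of the expansion of a polynomial in powers of the quadratic form with harmonic
coefficients. -/
theorem eq_zero_of_sum_quad_pow_mul [CharZero K] (hn : n ≠ 0) (hB : B.IsSymm) (hG : G.IsSymm)
    (hGB : G * B = 1) (m : ℕ) (d : ℕ → ℕ) (P : ℕ → MvPolynomial (Fin n) K)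
    (hP : ∀ k, (P k).IsHomogeneous (d k)) (h0 : ∀ k, lap G (P k) = 0)
    (h : ∑ k ∈ Finset.range (m + 1), quad B ^ (m - k) * P k = 0) : ∀ k ≤ m, P k = 0 := by
  induction m generalizing P with
  | zero =>
    intro k hk
    obtain rfl : k = 0 := by omega
    simpa using h
  | succ m ih =>
    have key : ∀ k ≤ m, P k = 0 := by
      -- The Laplacian kills the last term and lowers each other power of the quadratic form by one,
      -- at the cost of this nonzero factor, so the case `m` applies.
      let γ : ℕ → ℕ := fun k => 2 * (m - k + 1) * (n + 2 * d k + 2 * (m - k))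
      have hγ : ∀ k, (γ k : MvPolynomial (Fin n) K) ≠ 0 := fun k =>
        Nat.cast_ne_zero.2 (by positivity)
      intro k hk
      refine (mul_eq_zero.1 (ih (fun k => (γ k : MvPolynomial (Fin n) K) * P k) ?_ ?_ ?_ k
        hk)).resolve_left (hγ k)
      · intro k
        rw [← map_natCast C]
        simpa using (isHomogeneous_C (Fin n) (γ k : K)).mul (hP k)
      · intro k
        rw [← map_natCast C, ← smul_eq_C_mul, map_smul, h0, smul_zero]
      · have h' := congrArg (lap G) h
        rw [Finset.sum_range_succ, map_add, map_sum, Nat.sub_self, pow_zero, one_mul, h0, add_zero,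
          map_zero] at h'
        rw [← h']
        refine Finset.sum_congr rfl fun k hk => ?_
        have hk := Finset.mem_range.1 hk
        rw [show m + 1 - k = m - k + 1 by omega, lap_quad_pow_mul hB hG hGB (hP k) (h0 k)]
        ring
    intro k hk
    rcases hk.lt_or_eq with hk | rfl
    · exact key k (by omega)
    · rw [Finset.sum_range_succ, Finset.sum_eq_zero, zero_add] at h
      · simpa using h
      · intro k hk
        rw [key k (by have := Finset.mem_range.1 hk; omega), mul_zero]

/-- If the `D k` have the trace `2 r_k δ_k` with harmonic `δ_k`, then a linear relation between
the `Q^{m-k} D k` determines the harmonic part of each `D k`. -/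
theorem harmonic_parts_of_sum_eq_zero [CharZero K] (hn : n ≠ 0) (hB : B.IsSymm) (hG : G.IsSymm)
    (hGB : G * B = 1) (m : ℕ) (r : ℕ → ℕ) (hr : ∀ k, r (k + 1) = r k + 2)
    (D δ : ℕ → MvPolynomial (Fin n) K)
    (hD : ∀ k, (D k).IsHomogeneous (r k + 1)) (hδ : ∀ k, (δ k).IsHomogeneous (r k - 1))
    (hrδ : ∀ k, r k = 0 → δ k = 0)
    (hDδ : ∀ k, lap G (D k) = ((2 * r k : ℕ) : MvPolynomial (Fin n) K) * δ k)
    (h0 : ∀ k, lap G (δ k) = 0)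
    (h : ∑ k ∈ Finset.range (m + 1), quad B ^ (m - k) * D k = 0) :
    δ 0 = 0 ∧ ∀ k < m, D k - C ((r k : K) / ((n + 2 * (r k - 1) : ℕ) : K)) * (quad B * δ k) +
      C ((r (k + 1) : K) / ((n + 2 * (r (k + 1) - 1) : ℕ) : K)) * δ (k + 1) = 0 := by
  -- Chosen to make `H k` below harmonic: the Laplacian of `Q δ_k` is `(2n + 4(r_k - 1)) δ_k`, while
  -- that of `D k` is `2 r_k δ_k`. For `r_k = 0` the truncated subtraction is harmless, since then
  -- `δ_k = 0`.
  set c : ℕ → K := fun k => (r k : K) / ((n + 2 * (r k - 1) : ℕ) : K) with hc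
  have hc' : ∀ k, c k * ((n + 2 * (r k - 1) : ℕ) : K) = r k := fun k =>
    div_mul_cancel₀ _ (Nat.cast_ne_zero.2 (by omega))
  set H : ℕ → MvPolynomial (Fin n) K := fun k => D k - C (c k) * (quad B * δ k) with hH
  have hHhom : ∀ k, (H k).IsHomogeneous (r k + 1) := by
    intro k
    rcases Nat.eq_zero_or_pos (r k) with h | h
    · simpa [hH, hrδ k h] using hD k
    · refine (hD k).sub ?_
      have := (isHomogeneous_C (Fin n) (c k)).mul ((quad_isHomogeneous B).mul (hδ k))
      rwa [show 0 + (2 + (r k - 1)) = r k + 1 by omega] at this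
  have hHlap : ∀ k, lap G (H k) = 0 := by
    intro k
    rw [hH]
    simp only [map_sub]
    rw [← smul_eq_C_mul, map_smul, lap_quad_mul hB hG hGB (hδ k), h0, hDδ, smul_eq_C_mul,
      mul_zero, zero_add, ← mul_assoc, ← sub_mul]
    have : C (c k) * ((2 * n + 4 * (r k - 1) : ℕ) : MvPolynomial (Fin n) K) =
        ((2 * r k : ℕ) : MvPolynomial (Fin n) K) := by
      rw [← map_natCast C, ← C_mul, ← map_natCast C]
      congr 1
      rw [show 2 * n + 4 * (r k - 1) = 2 * (n + 2 * (r k - 1)) by ring, Nat.cast_mul, Nat.cast_mul,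
        ← hc' k]
      ring
    rw [this, sub_self, zero_mul]
  -- After substituting `D k = H k + c_k Q δ_k`, the relation is regrouped by powers of `Q`, with
  -- indices shifted by one: `E 0` is the coefficient of `Q^(m+1)` and `E (k + 1)` that of
  -- `Q^(m-k)`. There `H k` meets `c_(k+1) δ_(k+1)`, whose degree agrees because `r_(k+1) - 1 = r_k
  -- + 1`; for `k = m` no such partner exists.
  let e : ℕ → ℕ := fun k => Nat.casesOn k (r 0 - 1) fun k => r k + 1
  let E : ℕ → MvPolynomial (Fin n) K := fun k => Nat.casesOn k (C (c 0) * δ 0)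
    fun k => if k < m then H k + C (c (k + 1)) * δ (k + 1) else H k
  have hδC : ∀ k, (C (c k) * δ k).IsHomogeneous (r k - 1) := fun k => by
    simpa using (isHomogeneous_C (Fin n) (c k)).mul (hδ k)
  have hδlap : ∀ k, lap G (C (c k) * δ k) = 0 := fun k => by
    rw [← smul_eq_C_mul, map_smul, h0, smul_zero]
  have hE := eq_zero_of_sum_quad_pow_mul hn hB hG hGB (m + 1) e E (fun k => by
      cases k with
      | zero => exact hδC 0
      | succ k =>
        change (if k < m then H k + C (c (k + 1)) * δ (k + 1) else H k).IsHomogeneous (r k + 1)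
        have := hδC (k + 1)
        rw [hr, show r k + 2 - 1 = r k + 1 by omega] at this
        split_ifs
        exacts [(hHhom k).add this, hHhom k]) (fun k => by
      cases k with
      | zero => exact hδlap 0
      | succ k =>
        change lap G (if k < m then H k + C (c (k + 1)) * δ (k + 1) else H k) = 0
        split_ifs
        · rw [map_add, hHlap, hδlap, add_zero]
        · exact hHlap k) (by
      rw [Finset.sum_range_succ']
      have hsum : ∑ k ∈ Finset.range (m + 1), quad B ^ (m + 1 - (k + 1)) * E (k + 1) =
          ∑ k ∈ Finset.range (m + 1), quad B ^ (m - k) * H k +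
            ∑ k ∈ Finset.range m, quad B ^ (m - k) * (C (c (k + 1)) * δ (k + 1)) := by
        rw [Finset.sum_range_succ, Finset.sum_range_succ _ m, add_right_comm,
          ← Finset.sum_add_distrib]
        congr 1
        · refine Finset.sum_congr rfl fun k hk => ?_
          rw [Nat.add_sub_add_right, ← mul_add]
          exact congrArg _ (if_pos (Finset.mem_range.1 hk))
        · rw [Nat.add_sub_add_right]
          exact congrArg _ (if_neg (lt_irrefl m))
      have hδsum : ∑ k ∈ Finset.range (m + 1), quad B ^ (m - k) * (C (c k) * (quad B * δ k)) =
          ∑ k ∈ Finset.range m, quad B ^ (m - k) * (C (c (k + 1)) * δ (k + 1)) +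
            quad B ^ (m + 1) * (C (c 0) * δ 0) := by
        rw [Finset.sum_range_succ']
        congr 1
        · refine Finset.sum_congr rfl fun k hk => ?_
          have hk := Finset.mem_range.1 hk
          rw [show m - k = m - (k + 1) + 1 by omega, pow_succ]
          ring
        · rw [Nat.sub_zero, pow_succ]
          ring
      rw [hsum]
      simp only [hH, mul_sub, Finset.sum_sub_distrib, h, hδsum]
      change _ + quad B ^ (m + 1) * (C (c 0) * δ 0) = 0
      ring)
  constructor
  · rcases Nat.eq_zero_or_pos (r 0) with h' | h'
    · exact hrδ 0 h'
    · refine (mul_eq_zero.1 (hE 0 (Nat.zero_le _))).resolve_left ?_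
      rw [C_eq_zero]
      exact div_ne_zero (Nat.cast_ne_zero.2 h'.ne') (Nat.cast_ne_zero.2 (by omega))
  · intro k hk
    have := hE (k + 1) (by omega)
    change (if k < m then H k + C (c (k + 1)) * δ (k + 1) else H k) = 0 at this
    rwa [if_pos hk] at this

end Arrays

/-! ### Coordinate frames and the metric in a chart -/

/-! ### Calculus of partial derivatives -/

section PartialDeriv

variable {n : ℕ} {W : Type*} [NormedAddCommGroup W] [NormedSpace ℝ W]
  {y : EuclideanSpace ℝ (Fin n)}

theorem partialDeriv_congr {F F' : EuclideanSpace ℝ (Fin n) → W} (h : F =ᶠ[nhds y] F')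
    (p : Fin n) : partialDeriv F y p = partialDeriv F' y p := by
  rw [partialDeriv, h.fderiv_eq, partialDeriv]

theorem partialDeriv_const (w : W) (p : Fin n) : partialDeriv (fun _ => w) y p = 0 := by
  simp [partialDeriv]

theorem partialDeriv_add {F F' : EuclideanSpace ℝ (Fin n) → W} (hF : DifferentiableAt ℝ F y)
    (hF' : DifferentiableAt ℝ F' y) (p : Fin n) :
    partialDeriv (fun z => F z + F' z) y p = partialDeriv F y p + partialDeriv F' y p := by
  simp [partialDeriv, fderiv_fun_add hF hF']

theorem partialDeriv_sum {ι : Type*} {s : Finset ι} {F : ι → EuclideanSpace ℝ (Fin n) → W}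
    (hF : ∀ i ∈ s, DifferentiableAt ℝ (F i) y) (p : Fin n) :
    partialDeriv (fun z => ∑ i ∈ s, F i z) y p = ∑ i ∈ s, partialDeriv (F i) y p := by
  simp [partialDeriv, fderiv_fun_sum hF]

theorem partialDeriv_smul {r : EuclideanSpace ℝ (Fin n) → ℝ} {F : EuclideanSpace ℝ (Fin n) → W}
    (hr : DifferentiableAt ℝ r y) (hF : DifferentiableAt ℝ F y) (p : Fin n) :
    partialDeriv (fun z => r z • F z) y p =
      r y • partialDeriv F y p + partialDeriv r y p • F y := by
  simp [partialDeriv, fderiv_fun_smul hr hF]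

theorem partialDeriv_const_smul {F : EuclideanSpace ℝ (Fin n) → W} (r : ℝ)
    (hF : DifferentiableAt ℝ F y) (p : Fin n) :
    partialDeriv (fun z => r • F z) y p = r • partialDeriv F y p := by
  simp [partialDeriv, fderiv_fun_const_smul hF]

end PartialDeriv

/-! ### Coordinate frames, the metric and its Levi-Civita connection -/

section Frames

variable {n : ℕ} {M : Type*} [TopologicalSpace M] [ChartedSpace (EuclideanSpace ℝ (Fin n)) M]

/-- The matrix of the coordinate vectors of the chart around `c` in the standard basis. -/
def frameMatrix (c : M) (y : EuclideanSpace ℝ (Fin n)) : Matrix (Fin n) (Fin n) ℝ :=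
  Matrix.of fun i p => (show EuclideanSpace ℝ (Fin n) from coordVec c y p) i

theorem coordVec_eq_sum (c : M) (y : EuclideanSpace ℝ (Fin n)) (p : Fin n) :
    coordVec c y p = ∑ i, frameMatrix c y i p • tangentBasis ((extChartAt (𝓡 n) c).symm y) i := by
  have h := (EuclideanSpace.basisFun (Fin n) ℝ).sum_repr
    (show EuclideanSpace ℝ (Fin n) from coordVec c y p)
  simp only [EuclideanSpace.basisFun_apply] at h
  exact h.symm

variable [IsManifold (𝓡 n) ∞ M]

/-- Links the two frames in use: at the centre of its own chart the coordinate frame is the standard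
basis, so chart computations give the values of `covDeriv`. -/
theorem coordVec_self (x : M) (p : Fin n) :
    (coordVec x (extChartAt (𝓡 n) x x) p : EuclideanSpace ℝ (Fin n)) =
      EuclideanSpace.single p (1 : ℝ) := by
  have : IsManifold (𝓡 n) 1 M := .of_le (n := ∞) (by simp)
  have h := mfderivWithin_range_extChartAt_symm (I := 𝓡 n) (x := x)
  rw [ModelWithCorners.range_eq_univ, mfderivWithin_univ] at h
  exact congrArg (fun L : EuclideanSpace ℝ (Fin n) →L[ℝ] EuclideanSpace ℝ (Fin n) =>
    L (EuclideanSpace.single p (1 : ℝ))) h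

theorem frameMatrix_self (x : M) : frameMatrix x (extChartAt (𝓡 n) x x) = 1 := by
  ext i p
  have := congrArg (fun v : EuclideanSpace ℝ (Fin n) => v i) (coordVec_self x p)
  simpa [frameMatrix, Matrix.one_apply] using this

/-- The derivative of the chart is a right inverse of the derivative of the inverse chart, and for
square matrices a one-sided inverse suffices. -/
theorem isUnit_frameMatrix (c : M) {y : EuclideanSpace ℝ (Fin n)}
    (hy : y ∈ (extChartAt (𝓡 n) c).target) : IsUnit (frameMatrix c y) := by
  have : IsManifold (𝓡 n) 1 M := .of_le (n := ∞) (by simp)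
  have h := mfderivWithin_extChartAt_symm_comp_mfderiv_extChartAt (I := 𝓡 n) (x := c) hy
  rw [ModelWithCorners.range_eq_univ, mfderivWithin_univ] at h
  let L : EuclideanSpace ℝ (Fin n) →L[ℝ] EuclideanSpace ℝ (Fin n) :=
    mfderiv 𝓘(ℝ, EuclideanSpace ℝ (Fin n)) (𝓡 n) (extChartAt (𝓡 n) c).symm y
  let L' : EuclideanSpace ℝ (Fin n) →L[ℝ] EuclideanSpace ℝ (Fin n) :=
    mfderiv (𝓡 n) 𝓘(ℝ, EuclideanSpace ℝ (Fin n)) (extChartAt (𝓡 n) c)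
      ((extChartAt (𝓡 n) c).symm y)
  have h' : L.toLinearMap ∘ₗ L'.toLinearMap = LinearMap.id :=
    congrArg (fun T : EuclideanSpace ℝ (Fin n) →L[ℝ] EuclideanSpace ℝ (Fin n) => T.toLinearMap) h
  let b := (EuclideanSpace.basisFun (Fin n) ℝ).toBasis
  have hL : frameMatrix c y = LinearMap.toMatrix b b L.toLinearMap := by
    ext i p
    simp [frameMatrix, LinearMap.toMatrix_apply, b]
    rfl
  rw [hL]
  have := congrArg (LinearMap.toMatrix b b) h'
  rw [LinearMap.toMatrix_comp b b b, LinearMap.toMatrix_id] at this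
  exact IsUnit.of_mul_eq_one _ this

variable (g : Bundle.ContMDiffRiemannianMetric (𝓡 n) ∞ (EuclideanSpace ℝ (Fin n))
    (fun x : M => TangentSpace (𝓡 n) x))

theorem metricForm_apply (x : M) (u v : TangentSpace (𝓡 n) x) :
    metricForm g x u v = g.inner x u v := rfl

theorem gram_isSymm (x : M) : (gram g x).IsSymm := by
  ext p q
  exact g.symm x _ _

theorem metricMatrix_isSymm (c : M) (y : EuclideanSpace ℝ (Fin n)) :
    (metricMatrix g c y).IsSymm := by
  ext p q
  exact g.symm _ _ _

/-- Positive definiteness: a vector in the kernel of the Gram matrix would have norm zero. -/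
theorem isUnit_gram (x : M) : IsUnit (gram g x) := by
  rw [Matrix.isUnit_iff_isUnit_det, isUnit_iff_ne_zero]
  intro h0
  obtain ⟨v, hv, h⟩ := Matrix.exists_mulVec_eq_zero_iff.2 h0
  let w : TangentSpace (𝓡 n) x := ∑ p, v p • tangentBasis x p
  have hw : w = (WithLp.toLp 2 v : EuclideanSpace ℝ (Fin n)) := by
    have h := (EuclideanSpace.basisFun (Fin n) ℝ).sum_repr (WithLp.toLp 2 v)
    simp only [EuclideanSpace.basisFun_apply, EuclideanSpace.basisFun_repr] at h
    exact h
  have hw0 : w ≠ 0 := by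
    intro h
    rw [hw] at h
    exact hv (congrArg WithLp.ofLp h)
  have hpos := g.pos x w hw0
  rw [← metricForm_apply] at hpos
  have : metricForm g x w w = v ⬝ᵥ (gram g x).mulVec v := by
    simp only [w, map_sum, LinearMap.sum_apply, map_smul, LinearMap.smul_apply, smul_eq_mul,
      dotProduct, Matrix.mulVec, Finset.mul_sum, gram, Matrix.of_apply]
    rw [Finset.sum_comm]
    refine Finset.sum_congr rfl fun p _ => Finset.sum_congr rfl fun q _ => by ring
  rw [this, h, dotProduct_zero] at hpos
  exact lt_irrefl _ hpos

theorem metricMatrix_eq (c : M) (y : EuclideanSpace ℝ (Fin n)) :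
    metricMatrix g c y = (frameMatrix c y).transpose * gram g ((extChartAt (𝓡 n) c).symm y) *
      frameMatrix c y := by
  ext p q
  simp only [metricMatrix, Matrix.of_apply, coordVec_eq_sum, map_sum, LinearMap.sum_apply, map_smul,
    LinearMap.smul_apply, smul_eq_mul, Matrix.mul_apply, Matrix.transpose_apply, Finset.sum_mul,
    gram, Finset.mul_sum]
  exact Finset.sum_congr rfl fun i _ => Finset.sum_congr rfl fun j _ => by ring

theorem isUnit_metricMatrix (c : M) {y : EuclideanSpace ℝ (Fin n)}
    (hy : y ∈ (extChartAt (𝓡 n) c).target) : IsUnit (metricMatrix g c y) := by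
  rw [metricMatrix_eq]
  have := isUnit_frameMatrix c hy
  exact (((Matrix.isUnit_transpose _).2 this).mul (isUnit_gram g _)).mul this

theorem metricMatrix_self (x : M) : metricMatrix g x (extChartAt (𝓡 n) x x) = gram g x := by
  rw [metricMatrix_eq, frameMatrix_self, extChartAt_to_inv, Matrix.transpose_one, one_mul, mul_one]

/-- The contraction with the inverse metric does not depend on the frame. -/
theorem contraction_frame {W : Type*} [AddCommGroup W] [Module ℝ W] (c : M)
    {y : EuclideanSpace ℝ (Fin n)} (hy : y ∈ (extChartAt (𝓡 n) c).target) (β : Fin n → Fin n → W) :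
    ∑ p, ∑ q, (metricMatrix g c y)⁻¹ p q •
        ∑ i, ∑ j, (frameMatrix c y i p * frameMatrix c y j q) • β i j =
      ∑ i, ∑ j, (gram g ((extChartAt (𝓡 n) c).symm y))⁻¹ i j • β i j := by
  set A := frameMatrix c y
  set G := gram g ((extChartAt (𝓡 n) c).symm y)
  have hA : IsUnit A.det := (Matrix.isUnit_iff_isUnit_det _).1 (isUnit_frameMatrix c hy)
  have hAt : IsUnit A.transpose.det := by rwa [Matrix.det_transpose]
  have h : G⁻¹ = A * (metricMatrix g c y)⁻¹ * A.transpose := by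
    rw [metricMatrix_eq, Matrix.mul_inv_rev, Matrix.mul_inv_rev, ← mul_assoc,
      Matrix.mul_nonsing_inv _ hA, one_mul, mul_assoc, Matrix.nonsing_inv_mul _ hAt, mul_one]
  simp only [h, Matrix.mul_apply, Matrix.transpose_apply, Finset.sum_mul, Finset.sum_smul,
    Finset.smul_sum, smul_smul]
  calc _ = ∑ p, ∑ i, ∑ q, ∑ j, ((metricMatrix g c y)⁻¹ p q * (A i p * A j q)) • β i j :=
        Finset.sum_congr rfl fun p _ => Finset.sum_comm
    _ = ∑ i, ∑ p, ∑ j, ∑ q, ((metricMatrix g c y)⁻¹ p q * (A i p * A j q)) • β i j := by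
        rw [Finset.sum_comm]
        exact Finset.sum_congr rfl fun i _ => Finset.sum_congr rfl fun p _ => Finset.sum_comm
    _ = ∑ i, ∑ j, ∑ q, ∑ p, ((metricMatrix g c y)⁻¹ p q * (A i p * A j q)) • β i j := by
        refine Finset.sum_congr rfl fun i _ => ?_
        rw [Finset.sum_comm]
        exact Finset.sum_congr rfl fun j _ => Finset.sum_comm
    _ = _ := Finset.sum_congr rfl fun i _ => Finset.sum_congr rfl fun j _ =>
        Finset.sum_congr rfl fun q _ => Finset.sum_congr rfl fun p _ => by
          congr 1
          ring

theorem contDiffOn_metricMatrix (c : M) (p q : Fin n) :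
    ContDiffOn ℝ ∞ (fun y => metricMatrix g c y p q) (extChartAt (𝓡 n) c).target := by
  have : IsManifold (𝓡 n) 1 M := .of_le (n := ∞) (by simp)
  rw [← contMDiffOn_iff_contDiffOn]
  set s := (extChartAt (𝓡 n) c).target
  have hs : IsOpen s := isOpen_extChartAt_target c
  have hφ : ContMDiffOn 𝓘(ℝ, EuclideanSpace ℝ (Fin n)) (𝓡 n) ∞ (extChartAt (𝓡 n) c).symm s :=
    contMDiffOn_extChartAt_symm c
  -- The coordinate field is the tangent map of the inverse chart applied to a constant field, hence
  -- smooth into the tangent bundle.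
  have hv : ∀ p, ContMDiffOn 𝓘(ℝ, EuclideanSpace ℝ (Fin n)) (𝓡 n).tangent ∞
      (fun y => Bundle.TotalSpace.mk' (EuclideanSpace ℝ (Fin n))
        (E := fun x : M => TangentSpace (𝓡 n) x) ((extChartAt (𝓡 n) c).symm y) (coordVec c y p)) s := by
    intro p
    have h1 := hφ.contMDiffOn_tangentMapWithin (m := ∞) (by simp) hs.uniqueMDiffOn
    have h2 : ContMDiffOn 𝓘(ℝ, EuclideanSpace ℝ (Fin n))
        𝓘(ℝ, EuclideanSpace ℝ (Fin n)).tangent ∞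
        (fun y => (⟨y, EuclideanSpace.single p (1 : ℝ)⟩ :
          TangentBundle 𝓘(ℝ, EuclideanSpace ℝ (Fin n)) (EuclideanSpace ℝ (Fin n)))) s := by
      have : ContDiffOn ℝ ∞ (fun _ : EuclideanSpace ℝ (Fin n) =>
        (EuclideanSpace.single p (1 : ℝ) : EuclideanSpace ℝ (Fin n))) s := contDiffOn_const
      exact contMDiffOn_vectorSpace_iff_contDiffOn.2 this
    refine (h1.comp h2 (fun y hy => hy)).congr fun y hy => ?_
    simp only [Function.comp_apply, tangentMapWithin, coordVec]
    rw [mfderivWithin_of_isOpen hs hy]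
  have hg := g.contMDiff.comp_contMDiffOn hφ
  intro y hy
  have h : ContMDiffWithinAt 𝓘(ℝ, EuclideanSpace ℝ (Fin n)) ((𝓡 n).prod 𝓘(ℝ)) ∞
      (fun y => Bundle.TotalSpace.mk' ℝ (E := Bundle.Trivial M ℝ) ((extChartAt (𝓡 n) c).symm y)
        (g.inner ((extChartAt (𝓡 n) c).symm y) (coordVec c y p) (coordVec c y q))) s y := by
    apply ContMDiffWithinAt.clm_bundle_apply₂ (F₁ := EuclideanSpace ℝ (Fin n))
      (F₂ := EuclideanSpace ℝ (Fin n))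
    · exact hg y hy
    · exact hv p y hy
    · exact hv q y hy
  simp only [Bundle.contMDiffWithinAt_totalSpace] at h
  exact h.2

/-- Cramer's rule expresses the entries through determinants, which are polynomial in the entries of
the metric. -/
theorem contDiffOn_metricMatrix_inv (c : M) (p q : Fin n) :
    ContDiffOn ℝ ∞ (fun y => (metricMatrix g c y)⁻¹ p q) (extChartAt (𝓡 n) c).target := by
  have hdet : ∀ F : EuclideanSpace ℝ (Fin n) → Matrix (Fin n) (Fin n) ℝ,
      (∀ a b, ContDiffOn ℝ ∞ (fun y => F y a b) (extChartAt (𝓡 n) c).target) →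
        ContDiffOn ℝ ∞ (fun y => (F y).det) (extChartAt (𝓡 n) c).target := by
    intro F hF
    simp only [Matrix.det_apply]
    refine ContDiffOn.sum fun σ _ => ContDiffOn.const_smul _ ?_
    exact contDiffOn_prod fun i _ => hF _ _
  have h : ∀ y, (metricMatrix g c y)⁻¹ p q = (metricMatrix g c y).det⁻¹ *
      ((metricMatrix g c y).updateRow q (Pi.single p 1)).det := by
    intro y
    rw [Matrix.inv_def, Ring.inverse_eq_inv', Matrix.smul_apply, smul_eq_mul,
      Matrix.adjugate_apply]
  simp only [h]
  refine ((hdet _ fun a b => contDiffOn_metricMatrix g c a b).inv fun y hy => ?_).mul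
    (hdet _ fun a b => ?_)
  · exact ((Matrix.isUnit_iff_isUnit_det _).1 (isUnit_metricMatrix g c hy)).ne_zero
  · simp only [Matrix.updateRow_apply]
    split_ifs
    exacts [contDiffOn_const, contDiffOn_metricMatrix g c a b]

/-- The Christoffel symbols `Γ^q_{pr}` with fixed `p` as a matrix. -/
def christoffelMatrix (c : M) (y : EuclideanSpace ℝ (Fin n)) (p : Fin n) :
    Matrix (Fin n) (Fin n) ℝ :=
  Matrix.of fun q r => christoffel g c y q p r

theorem metricMatrix_mul_christoffelMatrix (c : M) {y : EuclideanSpace ℝ (Fin n)}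
    (hy : y ∈ (extChartAt (𝓡 n) c).target) (p a r : Fin n) :
    (metricMatrix g c y * christoffelMatrix g c y p) a r =
      (1 / 2 : ℝ) * (partialDeriv (fun z => metricMatrix g c z r a) y p
        + partialDeriv (fun z => metricMatrix g c z p a) y r
        - partialDeriv (fun z => metricMatrix g c z p r) y a) := by
  let S : Fin n → ℝ := fun l => partialDeriv (fun z => metricMatrix g c z r l) y p
        + partialDeriv (fun z => metricMatrix g c z p l) y r
        - partialDeriv (fun z => metricMatrix g c z p r) y l
  have h : (metricMatrix g c y * christoffelMatrix g c y p) a r =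
      (1 / 2 : ℝ) * (metricMatrix g c y).mulVec ((metricMatrix g c y)⁻¹.mulVec S) a := by
    simp only [Matrix.mul_apply, Matrix.mulVec, dotProduct, christoffelMatrix, Matrix.of_apply,
      christoffel, Finset.mul_sum, S]
    exact Finset.sum_congr rfl fun q _ => Finset.sum_congr rfl fun l _ => by ring
  rw [h, Matrix.mulVec_mulVec, Matrix.mul_nonsing_inv _
    ((Matrix.isUnit_iff_isUnit_det _).1 (isUnit_metricMatrix g c hy)), Matrix.one_mulVec]

/-- Compatibility of the Levi-Civita connection with the metric. -/
theorem partialDeriv_metricMatrix (c : M) {y : EuclideanSpace ℝ (Fin n)}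
    (hy : y ∈ (extChartAt (𝓡 n) c).target) (p a b : Fin n) :
    partialDeriv (fun z => metricMatrix g c z a b) y p =
      ((christoffelMatrix g c y p).transpose * metricMatrix g c y +
        metricMatrix g c y * christoffelMatrix g c y p) a b := by
  have h : ((christoffelMatrix g c y p).transpose * metricMatrix g c y) a b =
      (metricMatrix g c y * christoffelMatrix g c y p) b a := by
    rw [← Matrix.transpose_apply (_ * _), Matrix.transpose_mul,
      Matrix.transpose_transpose, (metricMatrix_isSymm g c y).eq]
  have hsymm : ∀ a b, (fun z => metricMatrix g c z a b) = fun z => metricMatrix g c z b a :=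
    fun a b => funext fun z => (metricMatrix_isSymm g c z).apply _ _
  rw [Matrix.add_apply, h, metricMatrix_mul_christoffelMatrix g c hy,
    metricMatrix_mul_christoffelMatrix g c hy, hsymm b a, hsymm p a, hsymm p b]
  ring

/-- Differentiate `g⁻¹ g = 1`, which holds on the whole chart, insert the compatibility of the
connection with `g`, and solve for the derivative of `g⁻¹`. -/
theorem partialDeriv_metricMatrix_inv (c : M) {y : EuclideanSpace ℝ (Fin n)}
    (hy : y ∈ (extChartAt (𝓡 n) c).target) (p a b : Fin n) :
    partialDeriv (fun z => (metricMatrix g c z)⁻¹ a b) y p =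
      -(christoffelMatrix g c y p * (metricMatrix g c y)⁻¹ +
        (metricMatrix g c y)⁻¹ * (christoffelMatrix g c y p).transpose) a b := by
  have hs : IsOpen (extChartAt (𝓡 n) c).target := isOpen_extChartAt_target c
  have hu : ∀ z ∈ (extChartAt (𝓡 n) c).target, IsUnit (metricMatrix g c z).det := fun z hz =>
    (Matrix.isUnit_iff_isUnit_det _).1 (isUnit_metricMatrix g c hz)
  have hd : ∀ a b, DifferentiableAt ℝ (fun z => metricMatrix g c z a b) y := fun a b =>
    ((contDiffOn_metricMatrix g c a b).contDiffAt (hs.mem_nhds hy)).differentiableAt (by simp)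
  have hd' : ∀ a b, DifferentiableAt ℝ (fun z => (metricMatrix g c z)⁻¹ a b) y := fun a b =>
    ((contDiffOn_metricMatrix_inv g c a b).contDiffAt (hs.mem_nhds hy)).differentiableAt (by simp)
  let G' : Matrix (Fin n) (Fin n) ℝ :=
    Matrix.of fun a b => partialDeriv (fun z => (metricMatrix g c z)⁻¹ a b) y p
  have key : G' * metricMatrix g c y + (metricMatrix g c y)⁻¹ *
      ((christoffelMatrix g c y p).transpose * metricMatrix g c y +
        metricMatrix g c y * christoffelMatrix g c y p) = 0 := by
    ext a b
    have h1 : (fun z => ∑ l, (metricMatrix g c z)⁻¹ a l * metricMatrix g c z l b) =ᶠ[nhds y]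
        fun _ => (1 : Matrix (Fin n) (Fin n) ℝ) a b := by
      filter_upwards [hs.mem_nhds hy] with z hz
      rw [← Matrix.mul_apply, Matrix.nonsing_inv_mul _ (hu z hz)]
    have h2 := partialDeriv_congr h1 p
    rw [partialDeriv_sum fun l _ => (hd' a l).fun_mul (hd l b), partialDeriv_const] at h2
    rw [Matrix.zero_apply, ← h2, Matrix.add_apply, Matrix.mul_apply, Matrix.mul_apply,
      ← Finset.sum_add_distrib]
    refine Finset.sum_congr rfl fun l _ => ?_
    have h5 := partialDeriv_smul (hd' a l) (hd l b) p
    simp only [smul_eq_mul] at h5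
    rw [h5, ← partialDeriv_metricMatrix g c hy, add_comm]
    rfl
  have h3 : G' = -(christoffelMatrix g c y p * (metricMatrix g c y)⁻¹ +
        (metricMatrix g c y)⁻¹ * (christoffelMatrix g c y p).transpose) := by
    have h4 := congrArg (· * (metricMatrix g c y)⁻¹) key
    simp only [add_mul, zero_mul, mul_add, mul_assoc, Matrix.mul_nonsing_inv _ (hu y hy),
      Matrix.nonsing_inv_mul_cancel_left _ _ (hu y hy), mul_one] at h4
    rw [eq_neg_iff_add_eq_zero, ← h4]
    abel
  exact congrFun (congrFun h3 a) b

end Frames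

/-! ### Tensor fields as polynomials on the tangent spaces -/

section Fields

open MvPolynomial

variable {𝕜 : Type*} [RCLike 𝕜] {n N : ℕ} {M : Type*} [TopologicalSpace M]
  [ChartedSpace (EuclideanSpace ℝ (Fin n)) M]

/-- The components of a tensor field at `x` in the standard basis of `T_xM`. -/
def stdComponents (f : TensorField 𝕜 n M N) (x : M) (a : Fin N → Fin n) : 𝕜 :=
  f x fun j => tangentBasis x (a j)

/-- The polynomial `w ↦ f(w, …, w)` of a tensor field at `x`. -/
def polyAt (f : TensorField 𝕜 n M N) (x : M) : MvPolynomial (Fin n) 𝕜 :=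
  toPoly (stdComponents f x)

theorem polyAt_isHomogeneous (f : TensorField 𝕜 n M N) (x : M) : (polyAt f x).IsHomogeneous N :=
  toPoly_isHomogeneous _

theorem ext_of_stdComponents {f f' : TensorField 𝕜 n M N} {x : M}
    (h : stdComponents f x = stdComponents f' x) : f x = f' x := by
  have key : ∀ T T' : MultilinearMap ℝ (fun _ : Fin N => EuclideanSpace ℝ (Fin n)) 𝕜,
      (∀ a : Fin N → Fin n, T (fun j => EuclideanSpace.single (a j) (1 : ℝ)) =
        T' fun j => EuclideanSpace.single (a j) (1 : ℝ)) → T = T' := by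
    intro T T' h
    refine Module.Basis.ext_multilinear
      (fun _ => (EuclideanSpace.basisFun (Fin n) ℝ).toBasis) fun a => ?_
    simpa only [OrthonormalBasis.coe_toBasis, EuclideanSpace.basisFun_apply] using h a
  exact key _ _ fun a => congrFun h a

theorem isSymmArray_stdComponents {f : TensorField 𝕜 n M N} {x : M}
    (h : ∀ π : Equiv.Perm (Fin N), (f x).domDomCongr π = f x) :
    IsSymmArray (stdComponents f x) := fun π a =>
  congrArg (fun T : MultilinearMap ℝ (fun _ : Fin N => TangentSpace (𝓡 n) x) 𝕜 =>
    T fun j => tangentBasis x (a j)) (h π)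

theorem domDomCongr_eq_of_isSymmArray {f : TensorField 𝕜 n M N} {x : M}
    (h : IsSymmArray (stdComponents f x)) (π : Equiv.Perm (Fin N)) :
    (f x).domDomCongr π = f x :=
  ext_of_stdComponents (f := fun x => (f x).domDomCongr π) (f' := f) (x := x)
    (funext fun a => h π a)

/-- Reduces every later identity between symmetric fields to a polynomial identity at each point. -/
theorem ext_of_polyAt {f f' : TensorField 𝕜 n M N}
    (hf : ∀ x (π : Equiv.Perm (Fin N)), (f x).domDomCongr π = f x)
    (hf' : ∀ x (π : Equiv.Perm (Fin N)), (f' x).domDomCongr π = f' x)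
    (h : ∀ x, polyAt f x = polyAt f' x) : f = f' := by
  funext x
  have h1 := isSymmArray_stdComponents (hf x)
  have h2 := isSymmArray_stdComponents (hf' x)
  exact ext_of_stdComponents (h1.ext h2 (h x))

theorem isSymmArray_components {f : TensorField 𝕜 n M N} (hf : IsSmoothSymmetric f) (c : M)
    (y : EuclideanSpace ℝ (Fin n)) : IsSymmArray (components f c y) := fun π a =>
  congrArg (fun T : MultilinearMap ℝ (fun _ : Fin N => EuclideanSpace ℝ (Fin n)) 𝕜 =>
    T fun j => coordVec c y (a j)) (hf.symm ((extChartAt (𝓡 n) c).symm y) π)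

theorem polyAt_zero (x : M) : polyAt (0 : TensorField 𝕜 n M N) x = 0 :=
  map_zero toPoly

theorem polyAt_add (f f' : TensorField 𝕜 n M N) (x : M) :
    polyAt (f + f') x = polyAt f x + polyAt f' x :=
  map_add toPoly (stdComponents f x) (stdComponents f' x)

theorem polyAt_smul (r : ℝ) (f : TensorField 𝕜 n M N) (x : M) :
    polyAt (r • f) x = C (r : 𝕜) * polyAt f x := by
  rw [polyAt, polyAt, ← smul_eq_C_mul, ← map_smul]
  congr 1
  ext a
  rw [Pi.smul_apply, smul_eq_mul, ← RCLike.real_smul_eq_coe_mul]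
  rfl

theorem polyAt_sum {ι : Type*} (s : Finset ι) (f : ι → TensorField 𝕜 n M N) (x : M) :
    polyAt (∑ i ∈ s, f i) x = ∑ i ∈ s, polyAt (f i) x := by
  classical
  induction s using Finset.induction_on with
  | empty => simp [polyAt_zero]
  | insert i s hi ih => rw [Finset.sum_insert hi, Finset.sum_insert hi, polyAt_add, ih]

theorem polyAt_castRank {N' : ℕ} (h : N = N') (f : TensorField 𝕜 n M N) (x : M) :
    polyAt (castRank h f) x = polyAt f x := by
  subst h
  rfl

theorem isSmoothSymmetric_zero : IsSmoothSymmetric (0 : TensorField 𝕜 n M N) where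
  symm _ _ := rfl
  smooth _ _ := contDiffOn_const (c := (0 : 𝕜))

theorem IsSmoothSymmetric.add {f f' : TensorField 𝕜 n M N} (hf : IsSmoothSymmetric f)
    (hf' : IsSmoothSymmetric f') : IsSmoothSymmetric (f + f') where
  symm x π := congrArg₂ (· + ·) (hf.symm x π) (hf'.symm x π)
  smooth c a := (hf.smooth c a).add (hf'.smooth c a)

theorem IsSmoothSymmetric.smul {f : TensorField 𝕜 n M N} (hf : IsSmoothSymmetric f) (r : ℝ) :
    IsSmoothSymmetric (r • f) where
  symm x π := congrArg (r • ·) (hf.symm x π)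
  smooth c a := (hf.smooth c a).const_smul r

theorem IsSmoothSymmetric.sum {ι : Type*} {s : Finset ι} {f : ι → TensorField 𝕜 n M N}
    (hf : ∀ i ∈ s, IsSmoothSymmetric (f i)) : IsSmoothSymmetric (∑ i ∈ s, f i) :=
  Finset.sum_induction _ _ (fun _ _ h h' => h.add h') isSmoothSymmetric_zero hf

theorem IsSmoothSymmetric.castRank {N' : ℕ} (h : N = N') {f : TensorField 𝕜 n M N}
    (hf : IsSmoothSymmetric f) : IsSmoothSymmetric (castRank h f) := by
  subst h
  exact hf

theorem domDomCongr_symmetrize {V : Type*} [AddCommGroup V] [Module ℝ V]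
    (T : MultilinearMap ℝ (fun _ : Fin N => V) 𝕜) (π : Equiv.Perm (Fin N)) :
    (symmetrize T).domDomCongr π = symmetrize T := by
  ext v
  simp only [symmetrize, MultilinearMap.domDomCongr_apply, smul_apply,
    sum_apply]
  congr 1
  exact Fintype.sum_equiv (Equiv.mulLeft π) _ _ fun ρ => rfl

/-- The variables commute, so all permuted arrays have the same polynomial and averaging changes
nothing. Thus the operator `σ` disappears from `i` and `d`. -/
theorem toPoly_symmetrize (c : (Fin N → Fin n) → 𝕜) :
    toPoly (fun a => (N.factorial : ℝ)⁻¹ • ∑ π : Equiv.Perm (Fin N), c (a ∘ π)) = toPoly c := by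
  have h : (fun a => (N.factorial : ℝ)⁻¹ • ∑ π : Equiv.Perm (Fin N), c (a ∘ π)) =
      ((N.factorial : 𝕜)⁻¹) • ∑ π : Equiv.Perm (Fin N), fun a => c (a ∘ π) := by
    ext a
    simp [RCLike.real_smul_eq_coe_mul, Finset.sum_apply]
  rw [h, map_smul, map_sum]
  simp only [toPoly_comp_perm, Finset.sum_const, Finset.card_univ, Fintype.card_perm,
    Fintype.card_fin]
  rw [← Nat.cast_smul_eq_nsmul 𝕜, smul_smul, inv_mul_cancel₀, one_smul]
  exact Nat.cast_ne_zero.2 N.factorial_ne_zero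

theorem map_cons_cons_sum {V : Type*} [AddCommGroup V] [Module ℝ V]
    (T : MultilinearMap ℝ (fun _ : Fin (N + 2) => V) 𝕜) (e : Fin n → V) (α β : Fin n → ℝ)
    (w : Fin N → V) :
    T (Fin.cons (∑ i, α i • e i) (Fin.cons (∑ j, β j • e j) w : Fin (N + 1) → V)) =
      ∑ i, ∑ j, (α i * β j) • T (Fin.cons (e i) (Fin.cons (e j) w : Fin (N + 1) → V)) := by
  have h1 : T (Fin.cons (∑ i, α i • e i) (Fin.cons (∑ j, β j • e j) w : Fin (N + 1) → V)) =
      ∑ i, α i • (T.curryLeft (e i)) (Fin.cons (∑ j, β j • e j) w : Fin (N + 1) → V) := by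
    rw [← MultilinearMap.curryLeft_apply, map_sum, sum_apply]
    simp only [map_smul, smul_apply]
  rw [h1]
  refine Finset.sum_congr rfl fun i _ => ?_
  rw [← MultilinearMap.curryLeft_apply, map_sum, sum_apply, Finset.smul_sum]
  simp only [map_smul, smul_apply, MultilinearMap.curryLeft_apply, smul_smul]

theorem IsSmoothSymmetric.differentiableAt {f : TensorField 𝕜 n M N} (hf : IsSmoothSymmetric f)
    (c : M) {y : EuclideanSpace ℝ (Fin n)} (hy : y ∈ (extChartAt (𝓡 n) c).target)
    (a : Fin N → Fin n) : DifferentiableAt ℝ (fun z => components f c z a) y :=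
  ((hf.smooth c a).contDiffAt ((isOpen_extChartAt_target c).mem_nhds hy)).differentiableAt (by simp)

variable [IsManifold (𝓡 n) ∞ M]

theorem components_self (f : TensorField 𝕜 n M N) (x : M) :
    components f x (extChartAt (𝓡 n) x x) = stdComponents f x := by
  ext a
  let f' : M → MultilinearMap ℝ (fun _ : Fin N => EuclideanSpace ℝ (Fin n)) 𝕜 := f
  have h : components f x (extChartAt (𝓡 n) x x) a =
      f' ((extChartAt (𝓡 n) x).symm (extChartAt (𝓡 n) x x))
        (fun j => coordVec x (extChartAt (𝓡 n) x x) (a j)) := rfl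
  rw [h, extChartAt_to_inv]
  exact congrArg (f' x) (funext fun j => coordVec_self x (a j))

variable (g : Bundle.ContMDiffRiemannianMetric (𝓡 n) ∞ (EuclideanSpace ℝ (Fin n))
    (fun x : M => TangentSpace (𝓡 n) x))

/-- The components of `f ⊗ g`. -/
theorem components_mulMetric (f : TensorField 𝕜 n M N) (c : M) (y : EuclideanSpace ℝ (Fin n))
    (a : Fin (N + 2) → Fin n) :
    components (mulMetric g f) c y a = ((N + 2).factorial : ℝ)⁻¹ •
      ∑ π : Equiv.Perm (Fin (N + 2)), metricMatrix g c y (a (π (Fin.natAdd N 0)))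
        (a (π (Fin.natAdd N 1))) • components f c y (fun j => a (π (Fin.castAdd 2 j))) := by
  simp only [components, mulMetric, symmetrize, smul_apply,
    sum_apply]
  rfl

theorem IsSmoothSymmetric.mulMetric {f : TensorField 𝕜 n M N} (hf : IsSmoothSymmetric f) :
    IsSmoothSymmetric (mulMetric g f) where
  symm x π := domDomCongr_symmetrize _ π
  smooth c a := by
    simp only [components_mulMetric]
    exact (ContDiffOn.sum fun π _ => (contDiffOn_metricMatrix g c _ _).smul
      (hf.smooth c _)).const_smul _

theorem IsSmoothSymmetric.mulMetricPow {f : TensorField 𝕜 n M N} (hf : IsSmoothSymmetric f)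
    (s : ℕ) : IsSmoothSymmetric (mulMetricPow g f s) := by
  induction s with
  | zero => exact hf
  | succ s ih => exact ih.mulMetric g

/-- The square of the norm as a polynomial on `T_xM`. -/
def metricPoly (𝕜 : Type*) [RCLike 𝕜] (x : M) : MvPolynomial (Fin n) 𝕜 :=
  quad ((gram g x).map (algebraMap ℝ 𝕜))

/-- The Laplacian of the metric on polynomials on `T_xM`. -/
def metricLap (𝕜 : Type*) [RCLike 𝕜] (x : M) :
    MvPolynomial (Fin n) 𝕜 →ₗ[𝕜] MvPolynomial (Fin n) 𝕜 :=
  lap ((gram g x)⁻¹.map (algebraMap ℝ 𝕜))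

theorem polyAt_mulMetric (f : TensorField 𝕜 n M N) (x : M) :
    polyAt (mulMetric g f) x = metricPoly g 𝕜 x * polyAt f x := by
  rw [polyAt, ← components_self, metricPoly, polyAt, ← toPoly_tensor, ← components_self,
    ← metricMatrix_self]
  refine Eq.trans (congrArg toPoly (funext fun a => ?_)) (toPoly_symmetrize _)
  rw [components_mulMetric]
  simp only [RCLike.real_smul_eq_coe_mul]
  rfl

theorem polyAt_mulMetricPow (f : TensorField 𝕜 n M N) (s : ℕ) (x : M) :
    polyAt (mulMetricPow g f s) x = metricPoly g 𝕜 x ^ s * polyAt f x := by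
  induction s with
  | zero => rw [pow_zero, one_mul]; rfl
  | succ s ih =>
    rw [pow_succ', mul_assoc, ← ih]
    exact polyAt_mulMetric g _ x

/-- The trace is defined pointwise in the standard basis; smoothness and differentiation need it
throughout a fixed chart, where `contraction_frame` supplies independence of the frame. -/
theorem components_trace (f : TensorField 𝕜 n M (N + 2)) (c : M) {y : EuclideanSpace ℝ (Fin n)}
    (hy : y ∈ (extChartAt (𝓡 n) c).target) (a : Fin N → Fin n) :
    components (trace g f) c y a = ∑ p, ∑ q, (metricMatrix g c y)⁻¹ p q •
      components f c y (Fin.cons p (Fin.cons q a : Fin (N + 1) → Fin n)) := by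
  let T : MultilinearMap ℝ (fun _ : Fin (N + 2) => EuclideanSpace ℝ (Fin n)) 𝕜 :=
    f ((extChartAt (𝓡 n) c).symm y)
  let e : Fin n → EuclideanSpace ℝ (Fin n) := fun i => EuclideanSpace.single i (1 : ℝ)
  let w : Fin N → EuclideanSpace ℝ (Fin n) := fun j => coordVec c y (a j)
  let β : Fin n → Fin n → 𝕜 := fun i j =>
    T (Fin.cons (e i) (Fin.cons (e j) w : Fin (N + 1) → EuclideanSpace ℝ (Fin n)))
  have h : ∀ p q, components f c y (Fin.cons p (Fin.cons q a : Fin (N + 1) → Fin n)) =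
      ∑ i, ∑ j, (frameMatrix c y i p * frameMatrix c y j q) • β i j := by
    intro p q
    rw [← map_cons_cons_sum]
    refine congrArg T (funext fun k => ?_)
    refine Fin.cases ?_ (fun k => ?_) k
    · exact coordVec_eq_sum c y p
    · refine Fin.cases ?_ (fun k => ?_) k
      · exact coordVec_eq_sum c y q
      · rfl
  simp only [h]
  rw [contraction_frame g c hy]
  simp only [components, trace, sum_apply, smul_apply,
    MultilinearMap.curryLeft_apply]
  rfl

theorem stdComponents_trace (f : TensorField 𝕜 n M (N + 2)) (x : M) (a : Fin N → Fin n) :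
    stdComponents (trace g f) x a = ∑ p, ∑ q, (algebraMap ℝ 𝕜 ((gram g x)⁻¹ p q)) *
      stdComponents f x (Fin.cons p (Fin.cons q a : Fin (N + 1) → Fin n)) := by
  rw [← components_self, components_trace g f x (mem_extChartAt_target x), metricMatrix_self,
    components_self]
  simp only [RCLike.real_smul_eq_coe_mul, RCLike.algebraMap_eq_ofReal]

theorem isSymmArray_trace {c : (Fin (N + 2) → Fin n) → 𝕜} (hc : IsSymmArray c)
    (B : Matrix (Fin n) (Fin n) 𝕜) :
    IsSymmArray fun a => ∑ p, ∑ q, B p q * c (Fin.cons p (Fin.cons q a : Fin (N + 1) → Fin n)) := by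
  intro π a
  refine Finset.sum_congr rfl fun p _ => Finset.sum_congr rfl fun q _ => ?_
  exact congrArg _ (((hc.cons p).cons q) π a)

theorem IsSmoothSymmetric.trace {f : TensorField 𝕜 n M (N + 2)} (hf : IsSmoothSymmetric f) :
    IsSmoothSymmetric (trace g f) where
  symm x := domDomCongr_eq_of_isSymmArray <| by
    have := isSymmArray_trace (isSymmArray_stdComponents (hf.symm x))
      ((gram g x)⁻¹.map (algebraMap ℝ 𝕜))
    convert this using 1
    exact funext fun a => stdComponents_trace g f x a
  smooth c a := by
    refine ContDiffOn.congr ?_ fun y hy => components_trace g f c hy a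
    exact ContDiffOn.sum fun p _ => ContDiffOn.sum fun q _ =>
      (contDiffOn_metricMatrix_inv g c p q).smul (hf.smooth c _)

theorem polyAt_trace {f : TensorField 𝕜 n M (N + 2)} (hf : IsSmoothSymmetric f) (x : M) :
    (((N + 2) * (N + 1) : ℕ) : MvPolynomial (Fin n) 𝕜) * polyAt (trace g f) x =
      metricLap g 𝕜 x (polyAt f x) := by
  rw [metricLap, polyAt, polyAt, ← toPoly_trace (isSymmArray_stdComponents (hf.symm x))]
  congr 2
  exact funext fun a => stdComponents_trace g f x a

/-- The polynomial of `∇_p f` at `x`. -/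
def nablaPoly (f : TensorField 𝕜 n M N) (x : M) (p : Fin n) : MvPolynomial (Fin n) 𝕜 :=
  toPoly (covDerivComponents g f x (extChartAt (𝓡 n) x x) p)

/-- The Christoffel symbols at `x` in the chart around `x`, with values in `𝕜`. -/
def connMatrix (𝕜 : Type*) [RCLike 𝕜] (x : M) (p : Fin n) : Matrix (Fin n) (Fin n) 𝕜 :=
  (christoffelMatrix g x (extChartAt (𝓡 n) x x) p).map (algebraMap ℝ 𝕜)

theorem nablaPoly_eq (f : TensorField 𝕜 n M N) (x : M) (p : Fin n) :
    nablaPoly g f x p =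
      toPoly (fun a => partialDeriv (fun z => components f x z a) (extChartAt (𝓡 n) x x) p) -
        connDer (connMatrix g 𝕜 x p) (polyAt f x) := by
  rw [polyAt, ← toPoly_connDer, ← map_sub, nablaPoly, ← components_self]
  congr 1
  ext a
  simp only [covDerivComponents, RCLike.real_smul_eq_coe_mul]
  rfl

theorem nablaPoly_add {f f' : TensorField 𝕜 n M N} (hf : IsSmoothSymmetric f)
    (hf' : IsSmoothSymmetric f') (x : M) (p : Fin n) :
    nablaPoly g (f + f') x p = nablaPoly g f x p + nablaPoly g f' x p := by
  have h : (fun a => partialDeriv (fun z => components (f + f') x z a)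
        (extChartAt (𝓡 n) x x) p) =
      (fun a => partialDeriv (fun z => components f x z a) (extChartAt (𝓡 n) x x) p) +
        fun a => partialDeriv (fun z => components f' x z a) (extChartAt (𝓡 n) x x) p :=
    funext fun a => partialDeriv_add (hf.differentiableAt x (mem_extChartAt_target x) a)
      (hf'.differentiableAt x (mem_extChartAt_target x) a) p
  rw [nablaPoly_eq, nablaPoly_eq, nablaPoly_eq, polyAt_add, map_add, h, map_add]
  ring

theorem nablaPoly_smul {f : TensorField 𝕜 n M N} (hf : IsSmoothSymmetric f) (r : ℝ) (x : M)
    (p : Fin n) : nablaPoly g (r • f) x p = C (r : 𝕜) * nablaPoly g f x p := by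
  have h : (fun a => partialDeriv (fun z => components (r • f) x z a)
        (extChartAt (𝓡 n) x x) p) =
      (r : 𝕜) • fun a => partialDeriv (fun z => components f x z a) (extChartAt (𝓡 n) x x) p := by
    ext a
    rw [Pi.smul_apply, smul_eq_mul, ← RCLike.real_smul_eq_coe_mul]
    exact partialDeriv_const_smul r (hf.differentiableAt x (mem_extChartAt_target x) a) p
  rw [nablaPoly_eq, nablaPoly_eq, polyAt_smul, ← smul_eq_C_mul,
    Derivation.map_smul, h, map_smul,
    ← smul_sub, smul_eq_C_mul]

theorem nablaPoly_zero (x : M) (p : Fin n) :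
    nablaPoly g (0 : TensorField 𝕜 n M N) x p = 0 := by
  have := nablaPoly_smul g (isSmoothSymmetric_zero (𝕜 := 𝕜) (n := n) (M := M) (N := N)) 0 x p
  simpa using this

theorem nablaPoly_sum {ι : Type*} {s : Finset ι} {f : ι → TensorField 𝕜 n M N}
    (hf : ∀ i ∈ s, IsSmoothSymmetric (f i)) (x : M) (p : Fin n) :
    nablaPoly g (∑ i ∈ s, f i) x p = ∑ i ∈ s, nablaPoly g (f i) x p := by
  classical
  induction s using Finset.induction_on with
  | empty => simp [nablaPoly_zero]
  | insert i s hi ih =>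
    rw [Finset.sum_insert hi, Finset.sum_insert hi, nablaPoly_add g (hf i (by simp))
      (IsSmoothSymmetric.sum fun j hj => hf j (by simp [hj])), ih fun j hj => hf j (by simp [hj])]

theorem nablaPoly_castRank {N' : ℕ} (h : N = N') (f : TensorField 𝕜 n M N) (x : M) (p : Fin n) :
    nablaPoly g (castRank h f) x p = nablaPoly g f x p := by
  subst h
  rfl

/-- The product rule, with the derivative of the metric written through the connection so that it
cancels against `connDer_quad`. -/
theorem toPoly_partialDeriv_mulMetric {f : TensorField 𝕜 n M N} (hf : IsSmoothSymmetric f) (x : M)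
    (p : Fin n) :
    toPoly (fun a => partialDeriv (fun z => components (mulMetric g f) x z a)
        (extChartAt (𝓡 n) x x) p) =
      metricPoly g 𝕜 x * toPoly (fun a => partialDeriv (fun z => components f x z a)
        (extChartAt (𝓡 n) x x) p) +
      quad ((connMatrix g 𝕜 x p).transpose * (gram g x).map (algebraMap ℝ 𝕜) +
        (gram g x).map (algebraMap ℝ 𝕜) * connMatrix g 𝕜 x p) * polyAt f x := by
  have hy := mem_extChartAt_target (I := 𝓡 n) x
  have hd : ∀ a b, DifferentiableAt ℝ (fun z => metricMatrix g x z a b) (extChartAt (𝓡 n) x x) :=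
    fun a b => ((contDiffOn_metricMatrix g x a b).contDiffAt
      ((isOpen_extChartAt_target x).mem_nhds hy)).differentiableAt (by simp)
  have hmat : (connMatrix g 𝕜 x p).transpose * (gram g x).map (algebraMap ℝ 𝕜) +
        (gram g x).map (algebraMap ℝ 𝕜) * connMatrix g 𝕜 x p =
      Matrix.of fun a b => algebraMap ℝ 𝕜
        (partialDeriv (fun z => metricMatrix g x z a b) (extChartAt (𝓡 n) x x) p) := by
    rw [connMatrix, ← metricMatrix_self, ← Matrix.transpose_map, ← Matrix.map_mul, ← Matrix.map_mul,
      ← Matrix.map_add _ (map_add _)]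
    ext a b
    rw [Matrix.map_apply, Matrix.of_apply, partialDeriv_metricMatrix g x hy]
  rw [hmat, metricPoly, polyAt, ← toPoly_tensor, ← toPoly_tensor, ← map_add, ← metricMatrix_self,
    ← components_self]
  refine Eq.trans (congrArg toPoly (funext fun a => ?_)) (toPoly_symmetrize _)
  have hdiff : ∀ π : Equiv.Perm (Fin (N + 2)), DifferentiableAt ℝ (fun z =>
      metricMatrix g x z (a (π (Fin.natAdd N 0))) (a (π (Fin.natAdd N 1))) •
        components f x z (fun j => a (π (Fin.castAdd 2 j)))) (extChartAt (𝓡 n) x x) := fun π =>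
    (hd _ _).fun_smul (hf.differentiableAt x hy _)
  simp only [components_mulMetric]
  rw [partialDeriv_const_smul _ (DifferentiableAt.fun_sum fun π _ => hdiff π),
    partialDeriv_sum fun π _ => hdiff π]
  congr 1
  refine Finset.sum_congr rfl fun π _ => ?_
  rw [partialDeriv_smul (hd _ _) (hf.differentiableAt x hy _)]
  simp only [RCLike.real_smul_eq_coe_mul]
  rfl

/-- Multiplication by the metric commutes with the covariant derivative. -/
theorem nablaPoly_mulMetric {f : TensorField 𝕜 n M N} (hf : IsSmoothSymmetric f) (x : M)
    (p : Fin n) : nablaPoly g (mulMetric g f) x p = metricPoly g 𝕜 x * nablaPoly g f x p := by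
  rw [nablaPoly_eq, nablaPoly_eq, polyAt_mulMetric, toPoly_partialDeriv_mulMetric g hf,
    Derivation.leibniz, smul_eq_mul, smul_eq_mul, ← connDer_quad, ← metricPoly]
  ring

theorem nablaPoly_mulMetricPow {f : TensorField 𝕜 n M N} (hf : IsSmoothSymmetric f) (s : ℕ) (x : M)
    (p : Fin n) :
    nablaPoly g (mulMetricPow g f s) x p = metricPoly g 𝕜 x ^ s * nablaPoly g f x p := by
  induction s with
  | zero => rw [pow_zero, one_mul]; rfl
  | succ s ih =>
    rw [pow_succ', mul_assoc, ← ih]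
    exact nablaPoly_mulMetric g (hf.mulMetricPow g s) x p

end Fields

/-! ### Inner derivative and divergence as polynomials, and their traces -/

section Derivatives

open MvPolynomial

variable {𝕜 : Type*} [RCLike 𝕜] {n N : ℕ} {M : Type*} [TopologicalSpace M]
  [ChartedSpace (EuclideanSpace ℝ (Fin n)) M] [IsManifold (𝓡 n) ∞ M]
  (g : Bundle.ContMDiffRiemannianMetric (𝓡 n) ∞ (EuclideanSpace ℝ (Fin n))
    (fun x : M => TangentSpace (𝓡 n) x))

theorem ofComponents_single (c : (Fin N → Fin n) → 𝕜) (a : Fin N → Fin n) :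
    ofComponents c (fun j => EuclideanSpace.single (a j) (1 : ℝ)) = c a := by
  rw [ofComponents, sum_apply, Finset.sum_eq_single a]
  · simp
  · intro b _ hb
    obtain ⟨j, hj⟩ := Function.ne_iff.1 hb
    have : (∏ i, if b i = a i then (1 : ℝ) else 0) = 0 :=
      Finset.prod_eq_zero (Finset.mem_univ j) (if_neg hj)
    simp [this]
  · simp

theorem stdComponents_covDeriv (f : TensorField 𝕜 n M N) (x : M) (a : Fin (N + 1) → Fin n) :
    stdComponents (covDeriv g f) x a =
      covDerivComponents g f x (extChartAt (𝓡 n) x x) (a 0) (fun j => a j.succ) :=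
  ofComponents_single _ a

theorem polyAt_innerDiff (f : TensorField 𝕜 n M N) (x : M) :
    polyAt (innerDiff g f) x = ∑ p, X p * nablaPoly g f x p := by
  have h : polyAt (innerDiff g f) x = toPoly (stdComponents (covDeriv g f) x) := by
    refine Eq.trans (congrArg toPoly (funext fun a => ?_)) (toPoly_symmetrize _)
    simp only [stdComponents, innerDiff, symmetrize, smul_apply, sum_apply]
    rfl
  rw [h, toPoly_cons]
  refine Finset.sum_congr rfl fun p _ => ?_
  simp only [stdComponents_covDeriv]
  rfl

theorem isSymmArray_covDerivComponents {f : TensorField 𝕜 n M N} (hf : IsSmoothSymmetric f) (c : M)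
    (y : EuclideanSpace ℝ (Fin n)) (p : Fin n) : IsSymmArray (covDerivComponents g f c y p) := by
  intro π a
  have h := fun z => isSymmArray_components hf c z π
  simp only [covDerivComponents, h]
  congr 1
  refine Fintype.sum_equiv π _ _ fun k => Finset.sum_congr rfl fun q _ => ?_
  have : Function.update (a ∘ π) k q = Function.update a (π k) q ∘ π :=
    (Function.update_comp_eq_of_injective a π.injective k q).symm
  rw [this, h]
  rfl

theorem stdComponents_trace_covDeriv (f : TensorField 𝕜 n M (N + 1)) (x : M) :
    stdComponents (trace g (covDeriv g f)) x = fun a => ∑ p, ∑ q,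
      (gram g x)⁻¹.map (algebraMap ℝ 𝕜) p q *
        covDerivComponents g f x (extChartAt (𝓡 n) x x) p (Fin.cons q a) := by
  ext a
  rw [stdComponents_trace]
  simp only [stdComponents_covDeriv]
  rfl

theorem domDomCongr_trace_covDeriv {f : TensorField 𝕜 n M (N + 1)} (hf : IsSmoothSymmetric f) (x : M)
    (π : Equiv.Perm (Fin N)) :
    (trace g (covDeriv g f) x).domDomCongr π = trace g (covDeriv g f) x := by
  refine domDomCongr_eq_of_isSymmArray ?_ π
  rw [stdComponents_trace_covDeriv]
  intro π a
  refine Finset.sum_congr rfl fun p _ => Finset.sum_congr rfl fun q _ => ?_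
  exact congrArg _ ((isSymmArray_covDerivComponents g hf x _ p).cons q π a)

theorem polyAt_trace_covDeriv {f : TensorField 𝕜 n M (N + 1)} (hf : IsSmoothSymmetric f) (x : M) :
    ((N + 1 : ℕ) : MvPolynomial (Fin n) 𝕜) * polyAt (trace g (covDeriv g f)) x =
      ∑ p, ∑ q, C ((gram g x)⁻¹.map (algebraMap ℝ 𝕜) p q) * pderiv q (nablaPoly g f x p) := by
  rw [polyAt, stdComponents_trace_covDeriv,
    toPoly_divergence fun p => isSymmArray_covDerivComponents g hf x _ p]
  rfl

theorem metricLap_polyAt {f : TensorField 𝕜 n M N} (hf : IsSmoothSymmetric f)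
    (h : IsTraceFree g f) (x : M) : metricLap g 𝕜 x (polyAt f x) = 0 := by
  match N, f, hf, h with
  | 0, f, _, _ => exact lap_toPoly_rank_zero _ _
  | 1, f, _, _ => exact lap_toPoly_rank_one _ _
  | N + 2, f, hf, h =>
    have h : trace g f = 0 := h
    rw [← polyAt_trace g hf, h, polyAt_zero, mul_zero]

theorem trace_eq_zero_of_metricLap {f : TensorField 𝕜 n M (N + 2)} (hf : IsSmoothSymmetric f)
    (h : ∀ x, metricLap g 𝕜 x (polyAt f x) = 0) : trace g f = 0 := by
  refine ext_of_polyAt (hf.trace g).symm isSmoothSymmetric_zero.symm fun x => ?_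
  have := polyAt_trace g hf x
  rw [h, mul_eq_zero, or_iff_right (Nat.cast_ne_zero.2 (by positivity))] at this
  rw [this, polyAt_zero]

theorem partialDeriv_metricMatrix_inv_map (x : M) (r : Fin n) :
    (Matrix.of fun a b => algebraMap ℝ 𝕜
      (partialDeriv (fun z => (metricMatrix g x z)⁻¹ a b) (extChartAt (𝓡 n) x x) r)) =
    -(connMatrix g 𝕜 x r * (gram g x)⁻¹.map (algebraMap ℝ 𝕜) +
      (gram g x)⁻¹.map (algebraMap ℝ 𝕜) * (connMatrix g 𝕜 x r).transpose) := by
  rw [connMatrix, ← metricMatrix_self, ← Matrix.transpose_map, ← Matrix.map_mul, ← Matrix.map_mul,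
    ← Matrix.map_add _ (map_add _)]
  ext a b
  rw [Matrix.neg_apply, Matrix.map_apply, Matrix.of_apply,
    partialDeriv_metricMatrix_inv g x (mem_extChartAt_target x), map_neg]

/-- The covariant derivative of a trace-free field is trace-free. -/
theorem metricLap_nablaPoly {f : TensorField 𝕜 n M N} (hf : IsSmoothSymmetric f)
    (h : IsTraceFree g f) (x : M) (r : Fin n) : metricLap g 𝕜 x (nablaPoly g f x r) = 0 := by
  match N, f, hf, h with
  | 0, f, _, _ => exact lap_toPoly_rank_zero _ _
  | 1, f, _, _ => exact lap_toPoly_rank_one _ _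
  | N + 2, f, hf, h =>
    have h0 := metricLap_polyAt g hf h x
    have h : trace g f = 0 := h
    set y := extChartAt (𝓡 n) x x with hy'
    have hy : y ∈ (extChartAt (𝓡 n) x).target := mem_extChartAt_target x
    have hs := (isOpen_extChartAt_target (I := 𝓡 n) x).mem_nhds hy
    set c' : (Fin (N + 2) → Fin n) → 𝕜 := fun a => partialDeriv (fun z => components f x z a) y r
      with hc'
    have hc's : IsSymmArray c' := by
      intro π a
      have h := fun z => isSymmArray_components hf x z π a
      simp only [hc', h]
    set G' : Matrix (Fin n) (Fin n) 𝕜 := Matrix.of fun a b => algebraMap ℝ 𝕜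
      (partialDeriv (fun z => (metricMatrix g x z)⁻¹ a b) y r) with hG'
    have hd : ∀ p q, DifferentiableAt ℝ (fun z => (metricMatrix g x z)⁻¹ p q) y := fun p q =>
      ((contDiffOn_metricMatrix_inv g x p q).contDiffAt hs).differentiableAt (by simp)
    -- The trace vanishes on the whole chart, so its partial derivative vanishes at `x`; the product
    -- rule splits it into a term with `∂f` and one with `∂g⁻¹`. The latter is then matched with the
    -- commutator term in `lap_connDer`.
    have key : (fun a => ∑ p, ∑ q, (gram g x)⁻¹.map (algebraMap ℝ 𝕜) p q *
          c' (Fin.cons p (Fin.cons q a : Fin (N + 1) → Fin n))) +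
        (fun a => ∑ p, ∑ q, G' p q *
          stdComponents f x (Fin.cons p (Fin.cons q a : Fin (N + 1) → Fin n))) = 0 := by
      ext a
      have h1 : (fun z => ∑ p, ∑ q, (metricMatrix g x z)⁻¹ p q •
          components f x z (Fin.cons p (Fin.cons q a : Fin (N + 1) → Fin n))) =ᶠ[nhds y]
          fun _ => 0 := by
        filter_upwards [hs] with z hz
        rw [← components_trace g f x hz a, h]
        rfl
      have h2 := partialDeriv_congr h1 r
      have hdiff : ∀ p q, DifferentiableAt ℝ (fun z => (metricMatrix g x z)⁻¹ p q •
          components f x z (Fin.cons p (Fin.cons q a : Fin (N + 1) → Fin n))) y := fun p q =>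
        (hd p q).fun_smul (hf.differentiableAt x hy _)
      rw [partialDeriv_const,
        partialDeriv_sum fun p _ => DifferentiableAt.fun_sum fun q _ => hdiff p q] at h2
      rw [Pi.zero_apply, ← h2, Pi.add_apply, ← Finset.sum_add_distrib]
      refine Finset.sum_congr rfl fun p _ => ?_
      rw [partialDeriv_sum fun q _ => hdiff p q, ← Finset.sum_add_distrib]
      refine Finset.sum_congr rfl fun q _ => ?_
      rw [partialDeriv_smul (hd p q) (hf.differentiableAt x hy _), hy', metricMatrix_self,
        components_self]
      simp only [RCLike.real_smul_eq_coe_mul]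
      rfl
    have h3 := congrArg (fun c => (((N + 2) * (N + 1) : ℕ) : MvPolynomial (Fin n) 𝕜) * toPoly c) key
    rw [map_add, mul_add (Nat.cast _), map_zero, mul_zero] at h3
    rw [toPoly_trace hc's, toPoly_trace (isSymmArray_stdComponents (hf.symm x)), hG', hy',
      partialDeriv_metricMatrix_inv_map, lap_neg, ← polyAt] at h3
    rw [nablaPoly_eq, map_sub]
    have h4 := lap_connDer ((gram g x)⁻¹.map (algebraMap ℝ 𝕜)) (connMatrix g 𝕜 x r) (polyAt f x)
    rw [show lap ((gram g x)⁻¹.map (algebraMap ℝ 𝕜)) (polyAt f x) = 0 from h0, map_zero,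
      zero_add] at h4
    rw [metricLap, h4]
    linear_combination h3

theorem gram_map_isSymm (x : M) : ((gram g x).map (algebraMap ℝ 𝕜)).IsSymm := by
  rw [Matrix.IsSymm, ← Matrix.transpose_map, (gram_isSymm g x).eq]

theorem gram_inv_map_isSymm (x : M) : ((gram g x)⁻¹.map (algebraMap ℝ 𝕜)).IsSymm := by
  rw [Matrix.IsSymm, ← Matrix.transpose_map, Matrix.transpose_nonsing_inv, (gram_isSymm g x).eq]

theorem gram_inv_map_mul (x : M) :
    (gram g x)⁻¹.map (algebraMap ℝ 𝕜) * (gram g x).map (algebraMap ℝ 𝕜) = 1 := by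
  rw [← Matrix.map_mul, Matrix.nonsing_inv_mul _
    ((Matrix.isUnit_iff_isUnit_det _).1 (isUnit_gram g x)), Matrix.map_one _ (map_zero _) (map_one _)]

/-- The trace of `df` is a multiple of `δf` if `f` is trace-free. -/
theorem metricLap_polyAt_innerDiff_succ {f : TensorField 𝕜 n M (N + 1)} (hf : IsSmoothSymmetric f)
    (h : IsTraceFree g f) (x : M) :
    metricLap g 𝕜 x (polyAt (innerDiff g f) x) =
      ((2 * (N + 1) : ℕ) : MvPolynomial (Fin n) 𝕜) * polyAt (trace g (covDeriv g f)) x := by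
  rw [Nat.cast_mul, mul_assoc, polyAt_trace_covDeriv g hf, polyAt_innerDiff, map_sum,
    Finset.mul_sum]
  refine Finset.sum_congr rfl fun p _ => ?_
  -- Only the cross term survives, as `∇_p f` is harmonic; summed over `p` it is the divergence.
  rw [metricLap, lap_X_mul (gram_inv_map_isSymm g x), ← metricLap, metricLap_nablaPoly g hf h,
    mul_zero, zero_add]
  rfl

/-- The divergence of a trace-free field is trace-free. -/
theorem metricLap_polyAt_trace_covDeriv {f : TensorField 𝕜 n M (N + 1)}
    (hf : IsSmoothSymmetric f) (h : IsTraceFree g f) (x : M) :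
    metricLap g 𝕜 x (polyAt (trace g (covDeriv g f)) x) = 0 := by
  have h1 := congrArg (metricLap g 𝕜 x) (polyAt_trace_covDeriv g hf x)
  rw [← map_natCast C, ← smul_eq_C_mul, map_smul, smul_eq_C_mul] at h1
  have h2 : metricLap g 𝕜 x (∑ p, ∑ q, C ((gram g x)⁻¹.map (algebraMap ℝ 𝕜) p q) *
      pderiv q (nablaPoly g f x p)) = 0 := by
    simp only [map_sum]
    refine Finset.sum_eq_zero fun p _ => Finset.sum_eq_zero fun q _ => ?_
    rw [← smul_eq_C_mul, map_smul, metricLap, ← pderiv_lap, ← metricLap,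
      metricLap_nablaPoly g hf h, map_zero, smul_zero]
  rw [h2, mul_eq_zero, C_eq_zero,
    or_iff_right (Nat.cast_ne_zero.2 N.succ_ne_zero)] at h1
  exact h1

end Derivatives

/-! ### Harmonic expansion of tensor fields and potentials of the divergences -/

section Main

open MvPolynomial

variable {𝕜 : Type*} [RCLike 𝕜] {n N : ℕ} {M : Type*} [TopologicalSpace M]
  [ChartedSpace (EuclideanSpace ℝ (Fin n)) M] [IsManifold (𝓡 n) ∞ M]
  (g : Bundle.ContMDiffRiemannianMetric (𝓡 n) ∞ (EuclideanSpace ℝ (Fin n))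
    (fun x : M => TangentSpace (𝓡 n) x))

theorem polyAt_divergence_rank_zero (hN : N = 0) (f : TensorField 𝕜 n M N) (x : M) :
    polyAt (divergence g f) x = 0 := by
  subst hN
  exact polyAt_zero (𝕜 := 𝕜) (n := n) (N := 0) x

theorem domDomCongr_divergence {f : TensorField 𝕜 n M N} (hf : IsSmoothSymmetric f) (x : M)
    (π : Equiv.Perm (Fin (N - 1))) : (divergence g f x).domDomCongr π = divergence g f x := by
  match N, f, hf, π with
  | 0, _, _, _ => rfl
  | _ + 1, _, hf, π => exact domDomCongr_trace_covDeriv g hf x π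

theorem metricLap_polyAt_innerDiff {f : TensorField 𝕜 n M N} (hf : IsSmoothSymmetric f)
    (h : IsTraceFree g f) (x : M) :
    metricLap g 𝕜 x (polyAt (innerDiff g f) x) =
      ((2 * N : ℕ) : MvPolynomial (Fin n) 𝕜) * polyAt (divergence g f) x := by
  match N, f, hf, h with
  | 0, f, _, _ =>
    rw [polyAt_divergence_rank_zero g rfl, mul_zero]
    exact lap_toPoly_rank_one _ _
  | _ + 1, _, hf, h => exact metricLap_polyAt_innerDiff_succ g hf h x

theorem metricLap_polyAt_divergence {f : TensorField 𝕜 n M N} (hf : IsSmoothSymmetric f)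
    (h : IsTraceFree g f) (x : M) : metricLap g 𝕜 x (polyAt (divergence g f) x) = 0 := by
  match N, f, hf, h with
  | 0, f, _, _ => rw [polyAt_divergence_rank_zero g rfl, map_zero]
  | _ + 1, _, hf, h => exact metricLap_polyAt_trace_covDeriv g hf h x

theorem isTraceFree_of_metricLap {f : TensorField 𝕜 n M N} (hf : IsSmoothSymmetric f)
    (h : ∀ x, metricLap g 𝕜 x (polyAt f x) = 0) : IsTraceFree g f := by
  rcases N with _ | _ | N
  · exact True.intro
  · exact True.intro
  · exact trace_eq_zero_of_metricLap g hf h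

theorem isTraceFree_zero : IsTraceFree g (0 : TensorField 𝕜 n M N) :=
  isTraceFree_of_metricLap g isSmoothSymmetric_zero fun x => by rw [polyAt_zero, map_zero]

theorem IsTraceFree.smul {f : TensorField 𝕜 n M N} (hf : IsSmoothSymmetric f)
    (h : IsTraceFree g f) (r : ℝ) : IsTraceFree g (r • f) :=
  isTraceFree_of_metricLap g (hf.smul r) fun x => by
    rw [polyAt_smul, ← smul_eq_C_mul, map_smul, metricLap_polyAt g hf h, smul_zero]

theorem innerDiff_symm (f : TensorField 𝕜 n M N) (x : M) (π : Equiv.Perm (Fin (N + 1))) :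
    (innerDiff g f x).domDomCongr π = innerDiff g f x := domDomCongr_symmetrize _ π

theorem polyAt_innerDiff_zero (x : M) :
    polyAt (innerDiff g (0 : TensorField 𝕜 n M N)) x = 0 := by
  simp [polyAt_innerDiff, nablaPoly_zero]

theorem polyAt_innerDiff_add {f f' : TensorField 𝕜 n M N} (hf : IsSmoothSymmetric f)
    (hf' : IsSmoothSymmetric f') (x : M) :
    polyAt (innerDiff g (f + f')) x = polyAt (innerDiff g f) x + polyAt (innerDiff g f') x := by
  simp only [polyAt_innerDiff, nablaPoly_add g hf hf', mul_add, Finset.sum_add_distrib]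

theorem polyAt_innerDiff_smul {f : TensorField 𝕜 n M N} (hf : IsSmoothSymmetric f) (r : ℝ) (x : M) :
    polyAt (innerDiff g (r • f)) x = C (r : 𝕜) * polyAt (innerDiff g f) x := by
  simp only [polyAt_innerDiff, nablaPoly_smul g hf, Finset.mul_sum]
  exact Finset.sum_congr rfl fun p _ => by ring

/-- Multiplication by the metric commutes with the inner differentiation. -/
theorem polyAt_innerDiff_mulMetric {f : TensorField 𝕜 n M N} (hf : IsSmoothSymmetric f) (x : M) :
    polyAt (innerDiff g (mulMetric g f)) x = metricPoly g 𝕜 x * polyAt (innerDiff g f) x := by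
  simp only [polyAt_innerDiff, nablaPoly_mulMetric g hf, Finset.mul_sum]
  exact Finset.sum_congr rfl fun p _ => by ring

theorem isPotential_zero : IsPotential g (0 : TensorField 𝕜 n M N) := by
  match N with
  | 0 => rfl
  | N + 1 =>
    refine ⟨0, isSmoothSymmetric_zero, ?_⟩
    refine ext_of_polyAt isSmoothSymmetric_zero.symm (innerDiff_symm g _) fun x => ?_
    rw [polyAt_zero, polyAt_innerDiff_zero]

/-- Disposes of the dimension in which the denominators `n + 2(r - 1)` and the factors in
`lap_quad_pow_mul` may vanish. -/
theorem divergence_eq_zero_of_dim_zero (hn : n = 0) (f : TensorField 𝕜 n M N) :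
    divergence g f = 0 := by
  subst hn
  match N, f with
  | 0, _ => rfl
  | _ + 1, f =>
    funext x
    change trace g (covDeriv g f) x = 0
    rw [trace, Fin.sum_univ_zero]

section Expansion

variable {ε m : ℕ}

/-- The sum `∑ i^{m-k} h^k`. -/
def expansionSum (h : ∀ k : Fin (m + 1), TensorField 𝕜 n M (ε + 2 * (k : ℕ))) :
    TensorField 𝕜 n M (ε + 2 * m) :=
  ∑ k : Fin (m + 1), castRank (by have := k.isLt; omega) (mulMetricPow g (h k) (m - (k : ℕ)))

theorem isSmoothSymmetric_expansionSum
    {h : ∀ k : Fin (m + 1), TensorField 𝕜 n M (ε + 2 * (k : ℕ))}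
    (hh : ∀ k, IsSmoothSymmetric (h k)) : IsSmoothSymmetric (expansionSum g h) :=
  IsSmoothSymmetric.sum fun k _ => ((hh k).mulMetricPow g _).castRank _

theorem polyAt_expansionSum (h : ∀ k : Fin (m + 1), TensorField 𝕜 n M (ε + 2 * (k : ℕ))) (x : M) :
    polyAt (expansionSum g h) x =
      ∑ k : Fin (m + 1), metricPoly g 𝕜 x ^ (m - (k : ℕ)) * polyAt (h k) x := by
  simp only [expansionSum, polyAt_sum, polyAt_castRank, polyAt_mulMetricPow]

theorem polyAt_innerDiff_expansionSum
    {h : ∀ k : Fin (m + 1), TensorField 𝕜 n M (ε + 2 * (k : ℕ))}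
    (hh : ∀ k, IsSmoothSymmetric (h k)) (x : M) :
    polyAt (innerDiff g (expansionSum g h)) x =
      ∑ k : Fin (m + 1), metricPoly g 𝕜 x ^ (m - (k : ℕ)) * polyAt (innerDiff g (h k)) x := by
  simp only [polyAt_innerDiff, expansionSum]
  simp only [nablaPoly_sum g fun k _ => ((hh k).mulMetricPow g _).castRank _, nablaPoly_castRank,
    nablaPoly_mulMetricPow g (hh _), Finset.mul_sum]
  rw [Finset.sum_comm]
  exact Finset.sum_congr rfl fun k _ => Finset.sum_congr rfl fun p _ => by ring

/-- Induction through the trace: rescaling the terms in the expansion of `jf` produces `w` such that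
`iw` and `f` have the same trace, and `f - iw` is the new trace-free term. Indexing by all of `ℕ`
avoids changes of index type; only `k ≤ m` matters. -/
theorem exists_polyAt_expansion (hε : ε = 0 ∨ ε = 1) (m : ℕ)
    {f : TensorField 𝕜 n M (ε + 2 * m)} (hf : IsSmoothSymmetric f) :
    ∃ h : ∀ k : ℕ, TensorField 𝕜 n M (ε + 2 * k), (∀ k, IsSmoothSymmetric (h k)) ∧
      (∀ k, IsTraceFree g (h k)) ∧ ∀ x, polyAt f x =
        ∑ k ∈ Finset.range (m + 1), metricPoly g 𝕜 x ^ (m - k) * polyAt (h k) x := by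
  induction m with
  | zero =>
    refine ⟨Function.update (fun _ => 0) 0 f, fun k => ?_, fun k => ?_, fun x => ?_⟩
    · rcases eq_or_ne k 0 with rfl | hk
      · rwa [Function.update_self]
      · rw [Function.update_of_ne hk]
        exact isSmoothSymmetric_zero
    · rcases eq_or_ne k 0 with rfl | hk
      · rw [Function.update_self]
        rcases hε with rfl | rfl <;> trivial
      · rw [Function.update_of_ne hk]
        exact isTraceFree_zero g
    · simp
  | succ m ih =>
    obtain ⟨u, hu, hu0, hsum⟩ := ih (hf.trace g)
    let γ : ℕ → ℕ := fun k => 2 * (m - k + 1) * (n + 2 * (ε + 2 * k) + 2 * (m - k))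
    -- The numerator is the factor between `jf` and the Laplacian of its polynomial; `γ k` is the
    -- factor by which the Laplacian undoes multiplication by `Q` on the `k`-th term.
    let s : ℕ → ℝ := fun k => (((ε + 2 * m + 2) * (ε + 2 * m + 1) : ℕ) : ℝ) / γ k
    let w : TensorField 𝕜 n M (ε + 2 * m) :=
      expansionSum g fun k : Fin (m + 1) => s k • u k
    have hw : IsSmoothSymmetric w := isSmoothSymmetric_expansionSum g fun k => (hu k).smul _
    let f₀ : TensorField 𝕜 n M (ε + 2 * (m + 1)) := f + (-1 : ℝ) • mulMetric g w
    have hf₀ : IsSmoothSymmetric f₀ := hf.add ((hw.mulMetric g).smul _)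
    have hpw : ∀ x, polyAt w x = ∑ k ∈ Finset.range (m + 1),
        metricPoly g 𝕜 x ^ (m - k) * polyAt (s k • u k) x := fun x => by
      rw [polyAt_expansionSum, Finset.sum_range]
    have hpf₀ : ∀ x, polyAt f₀ x = polyAt f x - metricPoly g 𝕜 x * polyAt w x := fun x => by
      have h1 : polyAt f₀ x = polyAt f x + polyAt ((-1 : ℝ) • mulMetric g w) x := polyAt_add _ _ x
      rw [h1, polyAt_smul, polyAt_mulMetric]
      simp [sub_eq_add_neg]
    have htr : ∀ x, metricLap g 𝕜 x (polyAt f₀ x) = 0 := by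
      intro x
      -- For `n = 0` some `γ k` may be zero, but then the Laplacian is an empty sum.
      rcases eq_or_ne n 0 with hn | hn
      · subst hn
        simp [metricLap, lap_apply]
      · have hγ : ∀ k, (γ k : ℝ) ≠ 0 := fun k => Nat.cast_ne_zero.2 (by positivity)
        have h1 : metricLap g 𝕜 x (polyAt f x) =
            (((ε + 2 * m + 2) * (ε + 2 * m + 1) : ℕ) : MvPolynomial (Fin n) 𝕜) *
              polyAt (trace g f) x := (polyAt_trace g hf x).symm
        rw [hpf₀, map_sub, h1, hpw, hsum, Finset.mul_sum, Finset.mul_sum, map_sum,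
          ← Finset.sum_sub_distrib]
        refine Finset.sum_eq_zero fun k _ => ?_
        have h3 : metricPoly g 𝕜 x * (metricPoly g 𝕜 x ^ (m - k) * polyAt (s k • u k) x) =
            C ((s k : ℝ) : 𝕜) * (metricPoly g 𝕜 x ^ (m - k + 1) * polyAt (u k) x) := by
          rw [polyAt_smul, pow_succ]
          ring
        rw [h3, ← smul_eq_C_mul, map_smul, metricLap, metricPoly, lap_quad_pow_mul (gram_map_isSymm g x) (gram_inv_map_isSymm g x)
            (gram_inv_map_mul g x) (polyAt_isHomogeneous (u k) x) (metricLap_polyAt g (hu k) (hu0 k) x),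
          smul_eq_C_mul]
        have h2 : C ((s k : ℝ) : 𝕜) * ((γ k : ℕ) : MvPolynomial (Fin n) 𝕜) =
            (((ε + 2 * m + 2) * (ε + 2 * m + 1) : ℕ) : MvPolynomial (Fin n) 𝕜) := by
          rw [← map_natCast C, ← C_mul, ← map_natCast C, ← RCLike.ofReal_natCast, ← RCLike.ofReal_mul,
            div_mul_cancel₀ _ (hγ k), RCLike.ofReal_natCast]
        rw [← h2, mul_assoc]
        exact sub_self _
    refine ⟨Function.update (fun k => s k • u k) (m + 1) f₀, fun k => ?_, fun k => ?_, fun x => ?_⟩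
    · rcases eq_or_ne k (m + 1) with rfl | hk
      · rwa [Function.update_self]
      · rw [Function.update_of_ne hk]
        exact (hu k).smul _
    · rcases eq_or_ne k (m + 1) with rfl | hk
      · rw [Function.update_self]
        exact isTraceFree_of_metricLap g hf₀ htr
      · rw [Function.update_of_ne hk]
        exact IsTraceFree.smul g (hu k) (hu0 k) _
    · rw [Finset.sum_range_succ, Function.update_self, Nat.sub_self, pow_zero, one_mul, hpf₀, hpw,
        Finset.mul_sum]
      have : ∑ k ∈ Finset.range (m + 1), metricPoly g 𝕜 x ^ (m + 1 - k) *
          polyAt (Function.update (fun k => s k • u k) (m + 1) f₀ k) x =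
          ∑ k ∈ Finset.range (m + 1), metricPoly g 𝕜 x *
            (metricPoly g 𝕜 x ^ (m - k) * polyAt (s k • u k) x) := by
        refine Finset.sum_congr rfl fun k hk => ?_
        have hk := Finset.mem_range.1 hk
        rw [Function.update_of_ne (by omega), ← mul_assoc, ← pow_succ',
          show m - k + 1 = m + 1 - k by omega]
      rw [this, add_sub_cancel]

theorem exists_isHarmonicExpansion (hε : ε = 0 ∨ ε = 1)
    {f : TensorField 𝕜 n M (ε + 2 * m)} (hf : IsSmoothSymmetric f) :
    ∃ h : ∀ k : Fin (m + 1), TensorField 𝕜 n M (ε + 2 * (k : ℕ)), IsHarmonicExpansion g f h := by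
  obtain ⟨h, hh, h0, hsum⟩ := exists_polyAt_expansion g hε m hf
  refine ⟨fun k => h k, fun k => hh k, fun k => h0 k, ?_⟩
  refine ext_of_polyAt hf.symm (isSmoothSymmetric_expansionSum g fun k => hh k).symm fun x => ?_
  rw [hsum, Finset.sum_range]
  exact (polyAt_expansionSum g (fun k : Fin (m + 1) => h k) x).symm

/-- The terms of the expansion of a Killing field: `δ h^0 = 0`, and `δ h^{k+1}` is a multiple of
the harmonic part of `d h^k`. -/
theorem polyAt_divergence_relations (hn : n ≠ 0) (h : ∀ k : ℕ, TensorField 𝕜 n M (ε + 2 * k))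
    (hh : ∀ k, IsSmoothSymmetric (h k)) (h0 : ∀ k, IsTraceFree g (h k))
    (hd : innerDiff g (expansionSum g fun k : Fin (m + 1) => h k) = 0) (x : M) :
    polyAt (divergence g (h 0)) x = 0 ∧ ∀ k < m, polyAt (innerDiff g (h k)) x -
      C (((ε + 2 * k : ℕ) : 𝕜) / ((n + 2 * (ε + 2 * k - 1) : ℕ) : 𝕜)) *
        (metricPoly g 𝕜 x * polyAt (divergence g (h k)) x) +
      C (((ε + 2 * (k + 1) : ℕ) : 𝕜) / ((n + 2 * (ε + 2 * (k + 1) - 1) : ℕ) : 𝕜)) *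
        polyAt (divergence g (h (k + 1))) x = 0 := by
  refine harmonic_parts_of_sum_eq_zero hn (gram_map_isSymm g x) (gram_inv_map_isSymm g x)
    (gram_inv_map_mul g x) m (fun k => ε + 2 * k) (fun k => by ring)
    (fun k => polyAt (innerDiff g (h k)) x) (fun k => polyAt (divergence g (h k)) x)
    (fun k => polyAt_isHomogeneous _ x) (fun k => polyAt_isHomogeneous _ x)
    (fun k hk => polyAt_divergence_rank_zero g hk _ x)
    (fun k => metricLap_polyAt_innerDiff g (hh k) (h0 k) x)
    (fun k => metricLap_polyAt_divergence g (hh k) (h0 k) x) ?_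
  have := polyAt_innerDiff_expansionSum g (h := fun k : Fin (m + 1) => h k) (fun k => hh k) x
  rw [hd, polyAt_zero] at this
  rw [Finset.sum_range]
  exact this.symm

/-- Induction on `k`: the relation expresses `δh^(k+1)` through `d h^k` and `Q δh^k`, and the latter
is exact once `δh^k` is, because `i` commutes with `d`. -/
theorem exists_potential (hn : n ≠ 0) (h : ∀ k : ℕ, TensorField 𝕜 n M (ε + 2 * k))
    (hh : ∀ k, IsSmoothSymmetric (h k)) (h0 : ∀ k, IsTraceFree g (h k))
    (hd : innerDiff g (expansionSum g fun k : Fin (m + 1) => h k) = 0) (k : ℕ) (hk : k < m) :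
    ∃ v : TensorField 𝕜 n M (ε + 2 * k), IsSmoothSymmetric v ∧
      ∀ x, polyAt (innerDiff g v) x = polyAt (divergence g (h (k + 1))) x := by
  let c : ℕ → ℝ := fun k => ((ε + 2 * k : ℕ) : ℝ) / ((n + 2 * (ε + 2 * k - 1) : ℕ) : ℝ)
  have hc : ∀ k, ((c k : ℝ) : 𝕜) =
      ((ε + 2 * k : ℕ) : 𝕜) / ((n + 2 * (ε + 2 * k - 1) : ℕ) : 𝕜) := fun k => by
    simp only [c, RCLike.ofReal_div, RCLike.ofReal_natCast]
  have hrel := fun x => polyAt_divergence_relations g hn h hh h0 hd x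
  simp only [← hc] at hrel
  have step : ∀ k < m, ∀ w : TensorField 𝕜 n M (ε + 2 * k), IsSmoothSymmetric w →
      (∀ x, polyAt (innerDiff g w) x = metricPoly g 𝕜 x * polyAt (divergence g (h k)) x) →
      ∃ v : TensorField 𝕜 n M (ε + 2 * k), IsSmoothSymmetric v ∧
        ∀ x, polyAt (innerDiff g v) x = polyAt (divergence g (h (k + 1))) x := by
    intro k hk w hw hw'
    have hs := (hh k).add (hw.smul (-c k))
    -- Obtained by solving `d h^k - c_k Q δh^k + c_(k+1) δh^(k+1) = 0` for the last divergence, with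
    -- `Q δh^k` replaced by `dw`.
    refine ⟨(-(c (k + 1))⁻¹) • (h k + (-c k) • w), hs.smul _, fun x => ?_⟩
    have h1 := (hrel x).2 k hk
    have hc0 : c (k + 1) ≠ 0 :=
      div_ne_zero (Nat.cast_ne_zero.2 (by omega)) (Nat.cast_ne_zero.2 (by omega))
    have h2 : C (((-(c (k + 1))⁻¹ : ℝ)) : 𝕜) * C ((c (k + 1) : ℝ) : 𝕜) =
        (-1 : MvPolynomial (Fin n) 𝕜) := by
      rw [← C_mul, ← RCLike.ofReal_mul, neg_mul, inv_mul_cancel₀ hc0]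
      simp
    rw [polyAt_innerDiff_smul g hs, polyAt_innerDiff_add g (hh k) (hw.smul _),
      polyAt_innerDiff_smul g hw, hw', RCLike.ofReal_neg (c k), C_neg]
    linear_combination C (((-(c (k + 1))⁻¹ : ℝ)) : 𝕜) * h1 -
      polyAt (divergence g (h (k + 1))) x * h2
  induction k with
  | zero =>
    -- The induction starts from `δh^0 = 0`, so `w = 0` serves.
    exact step 0 hk 0 isSmoothSymmetric_zero fun x => by
      rw [(hrel x).1, polyAt_innerDiff_zero]
      exact (mul_zero _).symm
  | succ k ih =>
    obtain ⟨v, hv, hv'⟩ := ih (by omega)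
    exact step (k + 1) hk (mulMetric g v) (hv.mulMetric g) fun x => by
      rw [← hv' x]
      exact polyAt_innerDiff_mulMetric g hv x

/-- The case `k = 0` needs actual vanishing: `δh^0` has rank zero for both parities, and there only
the zero function is potential. -/
theorem isPotential_divergence (h : ∀ k : ℕ, TensorField 𝕜 n M (ε + 2 * k))
    (hh : ∀ k, IsSmoothSymmetric (h k)) (h0 : ∀ k, IsTraceFree g (h k))
    (hd : innerDiff g (expansionSum g fun k : Fin (m + 1) => h k) = 0) (k : ℕ) (hk : k ≤ m) :
    IsPotential g (divergence g (h k)) := by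
  rcases eq_or_ne n 0 with hn | hn
  · rw [divergence_eq_zero_of_dim_zero g hn]
    exact isPotential_zero g
  · cases k with
    | zero =>
      have : divergence g (h 0) = 0 :=
        ext_of_polyAt (domDomCongr_divergence g (hh 0)) isSmoothSymmetric_zero.symm fun x => by
          rw [(polyAt_divergence_relations g hn h hh h0 hd x).1, polyAt_zero]
      rw [this]
      exact isPotential_zero g
    | succ k =>
      obtain ⟨v, hv, hv'⟩ := exists_potential g hn h hh h0 hd k hk
      exact ⟨v, hv, ext_of_polyAt (domDomCongr_divergence g (hh (k + 1))) (innerDiff_symm g v)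
        fun x => (hv' x).symm⟩

end Expansion

end Main

end KillingTensor

end

theorem mainTheorem12 {𝕜 : Type*} [RCLike 𝕜] {n : ℕ} {M : Type*} [TopologicalSpace M]
    [ChartedSpace (EuclideanSpace ℝ (Fin n)) M] [IsManifold (𝓡 n) ∞ M]
    (g : Bundle.ContMDiffRiemannianMetric (𝓡 n) ∞ (EuclideanSpace ℝ (Fin n))
      (fun x : M => TangentSpace (𝓡 n) x))
    (ε m : ℕ) (hε : ε = 0 ∨ ε = 1)
    (f : KillingTensor.TensorField 𝕜 n M (ε + 2 * m)) (hf : KillingTensor.IsKilling g f) :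
    (∃ h : ∀ k : Fin (m + 1), KillingTensor.TensorField 𝕜 n M (ε + 2 * (k : ℕ)),
      KillingTensor.IsHarmonicExpansion g f h) ∧
    ∀ h : ∀ k : Fin (m + 1), KillingTensor.TensorField 𝕜 n M (ε + 2 * (k : ℕ)),
      KillingTensor.IsHarmonicExpansion g f h →
        ∀ k : Fin (m + 1), KillingTensor.IsPotential g (KillingTensor.divergence g (h k)) := by
  refine ⟨KillingTensor.exists_isHarmonicExpansion g hε hf.smoothSymmetric, fun h hh k => ?_⟩
  -- Extension by zero beyond `m` keeps the terms smooth, symmetric and trace-free without affecting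
  -- the sum.
  let h' : ∀ k : ℕ, KillingTensor.TensorField 𝕜 n M (ε + 2 * k) := fun k =>
    if hk : k < m + 1 then h ⟨k, hk⟩ else 0
  have hh' : ∀ k : Fin (m + 1), h' k = h k := fun k => dif_pos k.isLt
  have hd : KillingTensor.innerDiff g
      (KillingTensor.expansionSum g fun k : Fin (m + 1) => h' k) = 0 := by
    simp only [hh']
    rw [← hf.innerDiff_eq_zero]
    exact congrArg _ hh.eq_sum.symm
  have := KillingTensor.isPotential_divergence g h' (fun k => ?_) (fun k => ?_) hd k (by omega)
  · rwa [hh'] at this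
  · by_cases hk : k < m + 1
    · simp only [h', dif_pos hk]
      exact hh.smoothSymmetric _
    · simp only [h', dif_neg hk]
      exact KillingTensor.isSmoothSymmetric_zero
  · by_cases hk : k < m + 1
    · simp only [h', dif_pos hk]
      exact hh.traceFree _
    · simp only [h', dif_neg hk]
      exact KillingTensor.isTraceFree_zero g
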